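/- Let $d\ge 1$ and let $p=\{(0,0),(1,0),(0,1),(1,1)\}$ be the sites of a $2\times 2$ plaquette, each carrying $\mathcal H=\mathbb C^d$. For $z\in p$ write $\bar z=(1,1)-z$. A gate $U\in\mathrm{End}(\mathcal H^{\otimes p})$ is called ternary unitary if it is unitary in the usual sense and also unitary when read as a matrix from the (input and output) legs of the sites with $x_1=0$ to those of the sites with $x_1=1$, and likewise in the direction $x_2$. For an even $L\ge 1$ consider the lattice $(\mathbb Z/L)^2$ with $\mathcal H$ at every site. Let $p(x)=x+p$ be the plaquette anchored at $x$, let $U_{p(x)}$ be $U$ acting on it, and let $$\mathbb U=\mathbb U_{\mathrm{oo}}\mathbb U_{\mathrm{ee}},\qquad \mathbb U_{\mathrm{ee}}=\bigotimes_{0\le i,j<L/2}U_{p(2i,2j)},\qquad \mathbb U_{\mathrm{oo}}=\bigotimes_{0\le i,j<L/2}U_{p(2i+1,2j+1)}.$$ For local operators $a,b\in\mathrm{End}(\mathcal H)$, acting as $a_x$, $b_y$ at the sites $x,y$, let $$D^{a,b}(x,y,t)=d^{-L^2}\,\mathrm{Tr}\big[a_x\,\mathbb U^{-t}\,b_y\,\mathbb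 U^{t}\big],$$ and for $z\in p$ let $M_z(a)=d^{-3}\,\mathrm{Tr}_{p\setminus\bar z}\big[U^\dagger a_zU\big]$, a linear map on $\mathrm{End}(\mathcal H)$. Let $U$ be ternary unitary. Then the following hold. 1. Each $M_z$ is a quantum channel (completely positive and trace preserving) with $M_z(\mathbb 1)=\mathbb 1$. 2. Let $t\ge 0$ be an integer, $L\ge 4t$, and let $a,b$ be traceless (for instance non-identity elements $a^\alpha,a^\beta$ of a Hilbert–Schmidt orthonormal operator basis that contains $\mathbb 1$). Put $s_i=+1$ if $y_i$ is odd and $s_i=-1$ if $y_i$ is even. Then $D^{a,b}(x,y,t)=0$ unless $x$ lies on the diagonal light ray of $y$, that is $x_i=y_i+2t\,s_i$ in $\mathbb Z/L$ for $i=1,2$. On the light ray, $|x_1-y_1|=|x_2-y_2|=2t$ (distance on the cycle $\mathbb Z/L$) and $$D^{a,b}(x,y,t)=\frac1d\,\mathrm{Tr}\big[M_{z}^{2t}(b)\,a\big],\qquad z=z(y)=(1,1)-(y\bmod 2),$$ where $z(y)$ is the position of $y$ in the plaquette of $\mathbb U_{\mathrm{oo}}$ that contains $y$. 3. For each $z\in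 p$ the eigenvalues of $M_z$, with algebraic multiplicity, can be listed as $\lambda_0=1,\lambda_1,\dots,\lambda_{d^2-1}$. For all traceless $a,b$ there are polynomials $c_1,\dots,c_{d^2-1}$, depending only on $U$, $z$, $a$, $b$, such that $$D^{a,b}(x,y,t)=\sum_{\chi=1}^{d^2-1}c_\chi(t)\,\lambda_\chi^{2t}$$ for all even $L\ge 1$, all integers $t\ge 0$ with $L\ge 4t$, and all $x,y$ on the light ray with $z(y)=z$, provided that $t=0$ or $2t\ge\nu$. Here $\nu$ is the size of the largest Jordan block of $M_z$ for the eigenvalue $0$ ($\nu=0$ if $M_z$ is invertible), and $0^0=1$. -/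

import Mathlib

open scoped Matrix

namespace TernaryCircuit

noncomputable section

/-- Operators on the local Hilbert space `ℂ^d`. -/
abbrev LocalOp (d : ℕ) := Matrix (Fin d) (Fin d) ℂ

/-- Operators on `⨂_{v ∈ V} ℂ^d`, written in the product basis, which is labelled by the
functions `V → Fin d`. The row index is the output, the column index the input. -/
abbrev Op (V : Type) (d : ℕ) := Matrix (V → Fin d) (V → Fin d) ℂ

/-- The four sites `(0,0), (1,0), (0,1), (1,1)` of a `2 × 2` plaquette. -/
abbrev Plaq := Fin 2 × Fin 2

/-- The site of the plaquette opposite to `z`, that is `(1,1) - z`. -/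
def opp (z : Plaq) : Plaq := (1 - z.1, 1 - z.2)

/-- The operator `a_v` that acts as `a` at the site `v` and as the identity elsewhere. -/
def localAt {V : Type} [Fintype V] [DecidableEq V] {d : ℕ} (v : V) (a : LocalOp d) : Op V d :=
  fun σ τ => if ∀ w, w ≠ v → σ w = τ w then a (σ v) (τ v) else 0

/-- The partial trace over all sites except `v`. -/
def ptraceExcept {V : Type} [Fintype V] [DecidableEq V] {d : ℕ} (v : V) (A : Op V d) :
    LocalOp d :=
  fun i j => ∑ σ : V → Fin d, if σ v = i then A σ (Function.update σ v j) else 0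

/-! ### Ternary unitary gates -/

/-- The gate read as a matrix along the first spatial direction: columns are the
(output, input) legs of the sites with `x₁ = 0`, rows those of the sites with `x₁ = 1`. -/
def reshape1 {d : ℕ} (U : Op Plaq d) :
    Matrix ((Fin 2 → Fin d) × (Fin 2 → Fin d)) ((Fin 2 → Fin d) × (Fin 2 → Fin d)) ℂ :=
  fun r l => U (fun z => if z.1 = 0 then l.1 z.2 else r.1 z.2)
    (fun z => if z.1 = 0 then l.2 z.2 else r.2 z.2)

/-- The gate read as a matrix along the second spatial direction: columns are the
(output, input) legs of the sites with `x₂ = 0`, rows those of the sites with `x₂ = 1`. -/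
def reshape2 {d : ℕ} (U : Op Plaq d) :
    Matrix ((Fin 2 → Fin d) × (Fin 2 → Fin d)) ((Fin 2 → Fin d) × (Fin 2 → Fin d)) ℂ :=
  fun r l => U (fun z => if z.2 = 0 then l.1 z.1 else r.1 z.1)
    (fun z => if z.2 = 0 then l.2 z.1 else r.2 z.1)

/-- Unitary in time and along both spatial directions. -/
def IsTernaryUnitary {d : ℕ} (U : Op Plaq d) : Prop :=
  (Uᴴ * U = 1 ∧ U * Uᴴ = 1) ∧
  ((reshape1 U)ᴴ * reshape1 U = 1 ∧ reshape1 U * (reshape1 U)ᴴ = 1) ∧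
  ((reshape2 U)ᴴ * reshape2 U = 1 ∧ reshape2 U * (reshape2 U)ᴴ = 1)

/-! ### The brickwork circuit on the periodic `L × L` lattice -/

/-- Sites of the periodic `L × L` lattice. -/
abbrev Site (L : ℕ) := ZMod L × ZMod L

/-- The site at position `z` of the plaquette `p(x)` anchored at `x`. -/
def plaqSite {L : ℕ} (x : Site L) (z : Plaq) : Site L :=
  (x.1 + ((z.1 : ℕ) : ZMod L), x.2 + ((z.2 : ℕ) : ZMod L))

/-- `⨂_{i,j < L/2} U_{p(2i+s, 2j+s)}`. For even `L` these plaquettes partition the lattice, and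
the matrix element of the tensor product is the product of those of the factors. -/
def layer {d : ℕ} (L : ℕ) (s : ℕ) (U : Op Plaq d) : Op (Site L) d :=
  fun σ τ => ∏ i : Fin (L / 2), ∏ j : Fin (L / 2),
    U (fun z => σ (plaqSite (((2 * i + s : ℕ) : ZMod L), ((2 * j + s : ℕ) : ZMod L)) z))
      (fun z => τ (plaqSite (((2 * i + s : ℕ) : ZMod L), ((2 * j + s : ℕ) : ZMod L)) z))

/-- One time step `𝕌 = 𝕌_oo 𝕌_ee`. -/
def timeStep {d : ℕ} (L : ℕ) [NeZero L] (U : Op Plaq d) : Op (Site L) d :=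
  layer L 1 U * layer L 0 U

/-- The infinite-temperature correlation `d^{-L²} Tr[a_x 𝕌^{-t} b_y 𝕌^t]`. -/
def correlation {d : ℕ} (L : ℕ) [NeZero L] (U : Op Plaq d) (a b : LocalOp d)
    (x y : Site L) (t : ℤ) : ℂ :=
  (1 / (d : ℂ) ^ (L ^ 2)) *
    (localAt x a * timeStep L U ^ (-t) * localAt y b * timeStep L U ^ t).trace

/-- The position that the site `y` takes in the plaquette of the layer `𝕌_oo` containing it:
the entry is `0` for an odd and `1` for an even coordinate, so this is `(1,1) - (y mod 2)`. -/
def posInOdd {L : ℕ} (y : Site L) : Plaq :=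
  (if Even y.1.val then 1 else 0, if Even y.2.val then 1 else 0)

/-- The displacement per layer along the light ray, in one coordinate. -/
def rayDir {L : ℕ} (c : ZMod L) : ZMod L := if Even c.val then -1 else 1

/-- The site `x` is the end point of the diagonal light ray of `2t` layers starting at `y`. -/
def OnLightRay {L : ℕ} (t : ℕ) (x y : Site L) : Prop :=
  x.1 = y.1 + ((2 * t : ℕ) : ZMod L) * rayDir y.1 ∧
  x.2 = y.2 + ((2 * t : ℕ) : ZMod L) * rayDir y.2

/-- The distance of two coordinates on the cycle `ℤ/L`. -/
def cycDist {L : ℕ} (c e : ZMod L) : ℕ := (c - e).valMinAbs.natAbs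

/-! ### The single-site map `M_z` -/

lemma localAt_add {V : Type} [Fintype V] [DecidableEq V] {d : ℕ} (v : V) (a b : LocalOp d) :
    localAt v (a + b) = localAt v a + localAt v b := by
  ext σ τ
  simp only [localAt, Matrix.add_apply]
  split_ifs <;> simp

lemma localAt_smul {V : Type} [Fintype V] [DecidableEq V] {d : ℕ} (v : V) (c : ℂ)
    (a : LocalOp d) : localAt v (c • a) = c • localAt v a := by
  ext σ τ
  simp only [localAt, Matrix.smul_apply]
  split_ifs <;> simp

lemma ptraceExcept_add {V : Type} [Fintype V] [DecidableEq V] {d : ℕ} (v : V) (A B : Op V d) :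
    ptraceExcept v (A + B) = ptraceExcept v A + ptraceExcept v B := by
  ext i j
  simp only [ptraceExcept, Matrix.add_apply, ← Finset.sum_add_distrib]
  refine Finset.sum_congr rfl fun σ _ => ?_
  split_ifs <;> simp

lemma ptraceExcept_smul {V : Type} [Fintype V] [DecidableEq V] {d : ℕ} (v : V) (c : ℂ)
    (A : Op V d) : ptraceExcept v (c • A) = c • ptraceExcept v A := by
  ext i j
  simp only [ptraceExcept, Matrix.smul_apply, Finset.smul_sum]
  refine Finset.sum_congr rfl fun σ _ => ?_
  split_ifs <;> simp

/-- `M_z(a) = d^{-3} Tr_{p ∖ z̄}[U† a_z U]`, as a linear map. -/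
def channelM {d : ℕ} (U : Op Plaq d) (z : Plaq) : Module.End ℂ (LocalOp d) where
  toFun a := (1 / (d : ℂ) ^ 3) • ptraceExcept (opp z) (Uᴴ * localAt z a * U)
  map_add' a b := by
    rw [localAt_add, Matrix.mul_add, Matrix.add_mul, ptraceExcept_add, smul_add]
  map_smul' c a := by
    rw [localAt_smul, Matrix.mul_smul, Matrix.smul_mul, ptraceExcept_smul, smul_comm]
    rfl

/-- Quantum channels (completely positive trace-preserving maps), in Kraus form. -/
def IsQuantumChannel {d : ℕ} (T : Module.End ℂ (LocalOp d)) : Prop :=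
  ∃ (n : ℕ) (K : Fin n → LocalOp d),
    (∀ a, T a = ∑ i, K i * a * (K i)ᴴ) ∧ ∑ i, (K i)ᴴ * K i = 1

end

end TernaryCircuit

/-! Let b(k) be `b_y` after Heisenberg evolution through k layers, alternately oo and ee. The
correlation is then `d^{-L²} Tr[a_x b(2t)]`. A layer enlarges supports by at most one site per
direction, so b(k) acts only on sites whose two coordinates are both within k of those of y
(`evolved_trivialOn`). The ray site sits before every layer at the same position z(y) of its brick,
and the layer moves it to the opposite corner (`exists_brick_ray`). As 2(k+1) ≤ L, neither
coordinate of the new ray site is reached by the cone of the preceding layer, even around the cycle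
(`not_near_ray`).

On the ray, ordinary unitarity is enough. Move the last layer onto the observable: all gates cancel
except the one on the observable's brick. That brick meets the previous cone in a single site, so
the gate survives only through a partial trace, which is the trace adjoint of `M_z`. Iterating gives
`M_z^{2t}` (`trace_ray`).

Off the ray, some coordinate p of x differs from that of the ray, so `a_x` is trivial on the whole
column through the ray site orthogonal to p. By induction on k, b(k) is trace-orthogonal to every X
trivial on its edge column (`trace_off_ray`). In one layer, the bricks at the edge have one side on
the new edge column, where b(k) is the identity, and the other on the old one. Tracing out the outer
side and using unitarity in direction p replaces each such gate by the depolarisation of its inner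
side (`twirl_dual`). Thus X becomes an operator trivial on the old edge column (`edge_gates_conj`).
At k = 0, tracelessness of b gives zero.

For the spectral expansion, matrix elements of `M_z^n` on a generalised eigenspace with eigenvalue μ
≠ 0 are polynomials in n times μ^n. Trace preservation makes generalised eigenvectors with μ ≠ 1
traceless, and unitality puts `1` in the eigenspace of 1. Taking traceless parts therefore removes
one copy of the eigenvalue 1 (`exists_expansion`). -/

set_option linter.unusedSectionVars false

namespace TernaryCircuit

noncomputable section

/-! ### Embedding operators on a set of sites -/

section Embedding

variable {W W' V : Type} [Fintype W] [DecidableEq W] [Fintype W'] [DecidableEq W']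
  [Fintype V] [DecidableEq V] {d : ℕ}

open Classical in
/-- The operator acting as `B` on the sites in the range of `f` and trivially elsewhere. -/
def embFun (f : W ↪ V) (B : Op W d) : Op V d := fun σ τ =>
  if ∀ v, v ∉ Set.range f → σ v = τ v then B (σ ∘ f) (τ ∘ f) else 0

lemma extend_comp_self (f : W ↪ V) (σ : V → Fin d) : Function.extend f (σ ∘ f) σ = σ := by
  funext v
  by_cases h : ∃ w, f w = v
  · obtain ⟨w, rfl⟩ := h
    simp [f.injective.extend_apply]
  · simp [Function.extend_apply' _ _ _ h]

lemma extend_eq_of_agree (f : W ↪ V) {σ ρ : V → Fin d}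
    (h : ∀ v, v ∉ Set.range f → σ v = ρ v) : Function.extend f (ρ ∘ f) σ = ρ := by
  funext v
  by_cases hv : ∃ w, f w = v
  · obtain ⟨w, rfl⟩ := hv
    simp [f.injective.extend_apply]
  · rw [Function.extend_apply' _ _ _ hv]
    exact h v hv

lemma extend_comp (f : W ↪ V) (β : W → Fin d) (σ : V → Fin d) :
    Function.extend f β σ ∘ f = β := by
  funext w
  simp [f.injective.extend_apply]

lemma extend_off (f : W ↪ V) (β : W → Fin d) (σ : V → Fin d) {v : V} (hv : v ∉ Set.range f) :
    Function.extend f β σ v = σ v :=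
  Function.extend_apply' _ _ _ hv

/-- Only intermediate configurations that agree with `σ` off the range of `f` contribute, and their
restrictions to `W` parametrise them. -/
lemma embFun_mul_apply (f : W ↪ V) (B : Op W d) (A : Op V d) (σ τ : V → Fin d) :
    (embFun f B * A) σ τ = ∑ β, B (σ ∘ f) β * A (Function.extend f β σ) τ := by
  classical
  simp only [Matrix.mul_apply, embFun, ite_mul, zero_mul]
  rw [← Finset.sum_filter]
  refine Finset.sum_nbij' (fun ρ => ρ ∘ f) (fun β => Function.extend f β σ) ?_ ?_ ?_ ?_ ?_
  · intro ρ _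
    exact Finset.mem_univ _
  · intro β _
    simp only [Finset.mem_filter, Finset.mem_univ, true_and]
    intro v hv
    rw [extend_off f β σ hv]
  · intro ρ hρ
    exact extend_eq_of_agree f (Finset.mem_filter.1 hρ).2
  · intro β _
    exact extend_comp f β σ
  · intro ρ hρ
    rw [extend_eq_of_agree f (Finset.mem_filter.1 hρ).2]

lemma mul_embFun_apply (f : W ↪ V) (B : Op W d) (A : Op V d) (σ τ : V → Fin d) :
    (A * embFun f B) σ τ = ∑ β, A σ (Function.extend f β τ) * B β (τ ∘ f) := by
  classical
  simp only [Matrix.mul_apply, embFun, mul_ite, mul_zero]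
  rw [← Finset.sum_filter]
  refine Finset.sum_nbij' (fun ρ => ρ ∘ f) (fun β => Function.extend f β τ) ?_ ?_ ?_ ?_ ?_
  · intro ρ _
    exact Finset.mem_univ _
  · intro β _
    simp only [Finset.mem_filter, Finset.mem_univ, true_and]
    intro v hv
    rw [extend_off f β τ hv]
  · intro ρ hρ
    exact extend_eq_of_agree f fun v hv => ((Finset.mem_filter.1 hρ).2 v hv).symm
  · intro β _
    exact extend_comp f β τ
  · intro ρ hρ
    rw [extend_eq_of_agree f fun v hv => ((Finset.mem_filter.1 hρ).2 v hv).symm]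

lemma embFun_one (f : W ↪ V) : embFun f (1 : Op W d) = 1 := by
  ext σ τ
  simp only [embFun, Matrix.one_apply]
  by_cases h : σ = τ
  · subst h
    simp
  · rw [if_neg h]
    split_ifs with h1 h2
    · refine absurd ?_ h
      rw [← extend_eq_of_agree f h1, ← h2, extend_comp_self]
    · rfl
    · rfl

lemma embFun_mul (f : W ↪ V) (B C : Op W d) : embFun f (B * C) = embFun f B * embFun f C := by
  ext σ τ
  rw [embFun_mul_apply]
  simp only [embFun, extend_comp, Matrix.mul_apply]
  by_cases h : ∀ v, v ∉ Set.range f → σ v = τ v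
  · rw [if_pos h]
    refine Finset.sum_congr rfl fun β _ => ?_
    rw [if_pos]
    intro v hv
    rw [extend_off f β σ hv, h v hv]
  · rw [if_neg h]
    refine (Finset.sum_eq_zero fun β _ => ?_).symm
    rw [if_neg, mul_zero]
    intro h'
    refine h fun v hv => ?_
    rw [← h' v hv, extend_off f β σ hv]

/-- `embFun` as an algebra homomorphism. -/
def emb (f : W ↪ V) : Op W d →ₐ[ℂ] Op V d :=
  AlgHom.ofLinearMap
    { toFun := embFun f
      map_add' := fun B C => by
        ext σ τ
        simp only [embFun, Matrix.add_apply]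
        split_ifs <;> simp
      map_smul' := fun c B => by
        ext σ τ
        simp only [embFun, Matrix.smul_apply, RingHom.id_apply]
        split_ifs <;> simp }
    (embFun_one f) (embFun_mul f)

open Classical in
lemma emb_apply (f : W ↪ V) (B : Op W d) (σ τ : V → Fin d) :
    emb f B σ τ = if ∀ v, v ∉ Set.range f → σ v = τ v then B (σ ∘ f) (τ ∘ f) else 0 := by
  change embFun f B σ τ = _
  simp only [embFun]

lemma emb_mul_apply (f : W ↪ V) (B : Op W d) (A : Op V d) (σ τ : V → Fin d) :
    (emb f B * A) σ τ = ∑ β, B (σ ∘ f) β * A (Function.extend f β σ) τ :=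
  embFun_mul_apply f B A σ τ

lemma mul_emb_apply (f : W ↪ V) (B : Op W d) (A : Op V d) (σ τ : V → Fin d) :
    (A * emb f B) σ τ = ∑ β, A σ (Function.extend f β τ) * B β (τ ∘ f) :=
  mul_embFun_apply f B A σ τ

lemma emb_conjTranspose (f : W ↪ V) (B : Op W d) : emb f Bᴴ = (emb f B)ᴴ := by
  ext σ τ
  simp only [Matrix.conjTranspose_apply, emb_apply]
  by_cases h : ∀ v, v ∉ Set.range f → σ v = τ v
  · rw [if_pos h, if_pos fun v hv => (h v hv).symm]
  · rw [if_neg h, if_neg fun h' => h fun v hv => (h' v hv).symm, star_zero]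

lemma emb_trans (g : W' ↪ W) (f : W ↪ V) (B : Op W' d) :
    emb (g.trans f) B = emb f (emb g B) := by
  ext σ τ
  simp only [emb_apply]
  by_cases h : ∀ v, v ∉ Set.range (g.trans f) → σ v = τ v
  · rw [if_pos h, if_pos, if_pos]
    · rfl
    · rintro w hw
      refine h _ ?_
      rintro ⟨u, hu⟩
      exact hw ⟨u, f.injective hu⟩
    · rintro v hv
      refine h v ?_
      rintro ⟨u, rfl⟩
      exact hv ⟨g u, rfl⟩
  · rw [if_neg h]
    split_ifs with h1 h2
    · refine absurd (fun v hv => ?_) h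
      by_cases hr : v ∈ Set.range f
      · obtain ⟨w, rfl⟩ := hr
        refine h2 w ?_
        rintro ⟨u, rfl⟩
        exact hv ⟨u, rfl⟩
      · exact h1 v hr
    · rfl
    · rfl

/-- The one-site embedding. -/
def siteEmb (v : V) : Unit ↪ V := ⟨fun _ => v, fun _ _ _ => rfl⟩

lemma localAt_eq_emb (v : V) (a : LocalOp d) :
    localAt v a = emb (siteEmb v) (a.submatrix (fun s => s ()) (fun s => s ())) := by
  ext σ τ
  have hr : ∀ w, w ∉ Set.range (siteEmb v) ↔ w ≠ v := fun w =>
    ⟨fun h e => h ⟨(), e.symm⟩, fun h ⟨_, e⟩ => h e.symm⟩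
  simp only [localAt, emb_apply, hr]
  by_cases h : ∀ w, w ≠ v → σ w = τ w
  · rw [if_pos h, if_pos h]
    rfl
  · rw [if_neg h, if_neg h]

lemma emb_localAt (f : W ↪ V) (w : W) (a : LocalOp d) :
    emb f (localAt w a) = localAt (f w) a := by
  rw [localAt_eq_emb, ← emb_trans, localAt_eq_emb]
  rfl

lemma localAt_mul (v : V) (a b : LocalOp d) : localAt v (a * b) = localAt v a * localAt v b := by
  simp only [localAt_eq_emb, ← map_mul]
  congr 1
  ext σ τ
  simp only [Matrix.submatrix_apply, Matrix.mul_apply]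
  exact (Fintype.sum_equiv (Equiv.funUnique Unit (Fin d)) _ _ fun _ => rfl).symm

lemma localAt_one (v : V) : localAt v (1 : LocalOp d) = 1 := by
  rw [localAt_eq_emb, ← map_one (emb (siteEmb v))]
  congr 1
  ext σ τ
  simp only [Matrix.submatrix_apply, Matrix.one_apply]
  congr 1
  simp only [eq_iff_iff]
  exact ⟨fun h => funext fun _ => h, fun h => congrFun h _⟩

lemma localAt_conjTranspose (v : V) (a : LocalOp d) : localAt v aᴴ = (localAt v a)ᴴ := by
  rw [localAt_eq_emb, localAt_eq_emb, ← emb_conjTranspose]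
  rfl

/-! ### Operators acting trivially on a set of sites -/

/-- `A` acts as the identity on the sites in `S`. -/
def TrivialOn (S : Set V) (A : Op V d) : Prop := ∀ v ∈ S, ∀ m, Commute (localAt v m) A

lemma TrivialOn.mono {S T : Set V} {A : Op V d} (h : TrivialOn S A) (hT : T ⊆ S) :
    TrivialOn T A := fun v hv => h v (hT hv)

lemma TrivialOn.mul {S : Set V} {A B : Op V d} (hA : TrivialOn S A) (hB : TrivialOn S B) :
    TrivialOn S (A * B) := fun v hv m => (hA v hv m).mul_right (hB v hv m)

lemma TrivialOn.one (S : Set V) : TrivialOn S (1 : Op V d) := fun _ _ _ => Commute.one_right _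

lemma TrivialOn.smul {S : Set V} {A : Op V d} (hA : TrivialOn S A) (c : ℂ) :
    TrivialOn S (c • A) := fun v hv m => (hA v hv m).smul_right c

lemma TrivialOn.sum {ι : Type} {S : Set V} (s : Finset ι) {A : ι → Op V d}
    (hA : ∀ i ∈ s, TrivialOn S (A i)) : TrivialOn S (∑ i ∈ s, A i) :=
  fun v hv m => Commute.sum_right _ _ _ fun i hi => hA i hi v hv m

lemma TrivialOn.conjTranspose {S : Set V} {A : Op V d} (hA : TrivialOn S A) :
    TrivialOn S Aᴴ := fun v hv m => by
  have h := (hA v hv mᴴ).star_star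
  rw [localAt_conjTranspose] at h
  simpa [Matrix.star_eq_conjTranspose] using h

lemma extend_siteEmb (v : V) (β : Unit → Fin d) (σ : V → Fin d) :
    Function.extend (siteEmb v) β σ = Function.update σ v (β ()) := by
  funext w
  by_cases h : w = v
  · subst h
    rw [Function.update_self]
    exact (siteEmb w).injective.extend_apply β σ ()
  · rw [Function.update_of_ne h]
    exact extend_off _ _ _ fun ⟨_, e⟩ => h e.symm

lemma localAt_mul_apply (v : V) (a : LocalOp d) (A : Op V d) (σ τ : V → Fin d) :
    (localAt v a * A) σ τ = ∑ i, a (σ v) i * A (Function.update σ v i) τ := by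
  rw [localAt_eq_emb, emb_mul_apply]
  simp only [extend_siteEmb]
  exact Fintype.sum_equiv (Equiv.funUnique Unit (Fin d)) _ _ fun _ => rfl

lemma mul_localAt_apply (v : V) (a : LocalOp d) (A : Op V d) (σ τ : V → Fin d) :
    (A * localAt v a) σ τ = ∑ i, A σ (Function.update τ v i) * a i (τ v) := by
  rw [localAt_eq_emb, mul_emb_apply]
  simp only [extend_siteEmb]
  exact Fintype.sum_equiv (Equiv.funUnique Unit (Fin d)) _ _ fun _ => rfl

lemma update_comp_of_notMem (f : W ↪ V) {v : V} (hv : v ∉ Set.range f) (σ : V → Fin d)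
    (i : Fin d) : Function.update σ v i ∘ f = σ ∘ f := by
  funext w
  exact Function.update_of_ne (fun e => hv ⟨w, e⟩) _ _

lemma trivialOn_emb (f : W ↪ V) (B : Op W d) : TrivialOn (Set.range f)ᶜ (emb f B) := by
  intro v hv m
  ext σ τ
  rw [localAt_mul_apply, mul_localAt_apply, Fintype.sum_eq_single (τ v),
    Fintype.sum_eq_single (σ v)]
  · simp only [emb_apply, update_comp_of_notMem f hv]
    rw [mul_comm]
    congr 1
    refine if_congr (forall₂_congr fun u _ => ?_) rfl rfl
    by_cases h : u = v
    · subst h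
      simp
    · simp [h]
  · intro i hi
    rw [emb_apply, if_neg, zero_mul]
    intro h
    have := h v hv
    rw [Function.update_self] at this
    exact hi this.symm
  · intro i hi
    rw [emb_apply, if_neg, mul_zero]
    intro h
    have := h v hv
    rw [Function.update_self] at this
    exact hi this

/-- Commuting with the diagonal matrix units at `v` forces `A` to be diagonal there. Together with
`TrivialOn.apply_update`, which uses the off-diagonal units, this recovers the tensor factor `1`
from commutation alone. -/
lemma TrivialOn.apply_eq_zero {S : Set V} {A : Op V d} (hA : TrivialOn S A) {σ τ : V → Fin d}
    {v : V} (hv : v ∈ S) (h : σ v ≠ τ v) : A σ τ = 0 := by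
  have := congrFun (congrFun (hA v hv (Matrix.single (σ v) (σ v) 1)).eq σ) τ
  rw [localAt_mul_apply, mul_localAt_apply, Fintype.sum_eq_single (σ v),
    Finset.sum_eq_zero] at this
  · simpa using this
  · intro i _
    rw [Matrix.single_apply_of_ne _ _ _ _ _ (fun e => h e.2), mul_zero]
  · intro i hi
    rw [Matrix.single_apply_of_ne _ _ _ _ _ (fun e => hi e.2.symm), zero_mul]

lemma TrivialOn.apply_update {S : Set V} {A : Op V d} (hA : TrivialOn S A) {σ τ : V → Fin d}
    {v : V} (hv : v ∈ S) (h : σ v = τ v) (i : Fin d) :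
    A (Function.update σ v i) (Function.update τ v i) = A σ τ := by
  have := congrFun (congrFun (hA v hv (Matrix.single (σ v) i 1)).eq σ) (Function.update τ v i)
  rw [localAt_mul_apply, mul_localAt_apply, Fintype.sum_eq_single i,
    Fintype.sum_eq_single (σ v)] at this
  · rw [h] at this
    simpa using this
  · intro j hj
    rw [Matrix.single_apply_of_ne _ _ _ _ _ (fun e => hj e.1.symm), mul_zero]
  · intro j hj
    rw [Matrix.single_apply_of_ne _ _ _ _ _ (fun e => hj e.2.symm), zero_mul]

lemma TrivialOn.apply_piecewise {S : Set V} {A : Op V d} (hA : TrivialOn S A)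
    {σ τ : V → Fin d} (T : Finset V) (hT : ∀ v ∈ T, v ∈ S) (h : ∀ v ∈ T, σ v = τ v)
    (ρ : V → Fin d) : A (T.piecewise ρ σ) (T.piecewise ρ τ) = A σ τ := by
  induction T using Finset.induction_on with
  | empty => simp
  | insert v T hv ih =>
    rw [Finset.piecewise_insert, Finset.piecewise_insert,
      hA.apply_update (hT v (Finset.mem_insert_self _ _)),
      ih (fun u hu => hT u (Finset.mem_insert_of_mem hu))
        (fun u hu => h u (Finset.mem_insert_of_mem hu))]
    simp [hv, h v (Finset.mem_insert_self _ _)]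

lemma TrivialOn.apply_extend {f : W ↪ V} {A : Op V d} (hA : TrivialOn (Set.range f) A)
    {σ τ : V → Fin d} (h : ∀ w, σ (f w) = τ (f w)) (β : W → Fin d) :
    A (Function.extend f β σ) (Function.extend f β τ) = A σ τ := by
  have key := hA.apply_piecewise (σ := σ) (τ := τ) (Finset.univ.map f) (by simp) (by simpa using h)
    (Function.extend f β σ)
  rw [← key]
  congr 1
  · funext v
    by_cases hv : v ∈ Finset.univ.map f
    · simp [hv]
    · rw [Finset.piecewise_eq_of_notMem _ _ _ hv, extend_off]
      simpa using hv
  · funext v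
    by_cases hv : v ∈ Finset.univ.map f
    · rw [Finset.piecewise_eq_of_mem _ _ _ hv]
      obtain ⟨w, _, rfl⟩ := Finset.mem_map.1 hv
      simp [f.injective.extend_apply]
    · rw [Finset.piecewise_eq_of_notMem _ _ _ hv, extend_off]
      simpa using hv

/-- Passes from one-site operators to arbitrary, possibly entangled, ones: the entries of `A` are
diagonal on the range of `f` and independent of the common values there. -/
lemma TrivialOn.commute_emb {f : W ↪ V} {A : Op V d} (hA : TrivialOn (Set.range f) A)
    (B : Op W d) : Commute (emb f B) A := by
  ext σ τ
  rw [emb_mul_apply, mul_emb_apply, Fintype.sum_eq_single (τ ∘ f),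
    Fintype.sum_eq_single (σ ∘ f), mul_comm]
  · congr 1
    have := hA.apply_extend (f := f) (σ := Function.extend f (τ ∘ f) σ) (τ := τ)
      (fun w => congrFun (extend_comp f (τ ∘ f) σ) w) (σ ∘ f)
    rw [← this]
    congr 1
    funext v
    by_cases hv : ∃ w, f w = v
    · obtain ⟨w, rfl⟩ := hv
      simp [f.injective.extend_apply]
    · rw [extend_off _ _ _ hv, extend_off _ _ _ hv]
  · intro β hβ
    obtain ⟨w, hw⟩ := Function.ne_iff.1 hβ
    rw [hA.apply_eq_zero ⟨w, rfl⟩, zero_mul]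
    rw [f.injective.extend_apply]
    exact hw.symm
  · intro β hβ
    obtain ⟨w, hw⟩ := Function.ne_iff.1 hβ
    rw [hA.apply_eq_zero ⟨w, rfl⟩, mul_zero]
    rw [f.injective.extend_apply]
    exact hw

lemma commute_emb_emb {f : W ↪ V} {g : W' ↪ V} (h : ∀ w w', f w ≠ g w') (B : Op W d)
    (C : Op W' d) : Commute (emb f B) (emb g C) :=
  ((trivialOn_emb g C).mono (by rintro _ ⟨w, rfl⟩ ⟨w', e⟩; exact h w w' e.symm)).commute_emb B

/-! ### Unnormalised depolarisation of a set of sites -/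

/-- The partial trace over the range of `h`, tensored with the identity there. -/
def twirl (h : W ↪ V) (X : Op V d) : Op V d :=
  ∑ γ : W → Fin d, ∑ δ : W → Fin d,
    emb h (Matrix.single γ δ 1) * X * emb h (Matrix.single δ γ 1)

lemma sum_single_self : ∑ γ : W → Fin d, (Matrix.single γ γ 1 : Op W d) = 1 := by
  ext σ τ
  simp only [Matrix.sum_apply, Matrix.one_apply]
  by_cases h : σ = τ
  · subst h
    rw [if_pos rfl, Fintype.sum_eq_single σ]
    · simp
    · intro γ hγ
      exact Matrix.single_apply_of_ne _ _ _ _ _ fun e => hγ e.1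
  · rw [if_neg h]
    exact Finset.sum_eq_zero fun γ _ =>
      Matrix.single_apply_of_ne _ _ _ _ _ fun e => h (e.1.symm.trans e.2)

/-- `X` moves past the matrix units. The sum over `γ` then resolves the identity, and the free sum
over `δ` counts the `d ^ card W` configurations. -/
lemma twirl_of_trivialOn {h : W ↪ V} {X : Op V d} (hX : TrivialOn (Set.range h) X) :
    twirl h X = (d : ℂ) ^ Fintype.card W • X := by
  have : ∀ γ δ : W → Fin d, emb h (Matrix.single γ δ 1) * X * emb h (Matrix.single δ γ 1) =
      emb h (Matrix.single γ γ 1) * X := fun γ δ => by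
    rw [mul_assoc, ← (hX.commute_emb _).eq, ← mul_assoc, ← map_mul,
      Matrix.single_mul_single_same, mul_one]
  simp only [twirl, this, Finset.sum_const, Finset.card_univ, Fintype.card_pi, Fintype.card_fin,
    Finset.prod_const]
  rw [← Finset.smul_sum, ← Finset.sum_mul, ← map_sum, sum_single_self, map_one, one_mul,
    ← Nat.cast_smul_eq_nsmul ℂ]
  simp

/-- Self-adjointness for the trace pairing, by cyclicity and exchange of `γ` and `δ`. It allows
sites where one factor is trivial to be traced out of the other. -/
lemma trace_twirl_mul (h : W ↪ V) (X Y : Op V d) :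
    (twirl h X * Y).trace = (X * twirl h Y).trace := by
  simp only [twirl, Finset.sum_mul, Finset.mul_sum, Matrix.trace_sum]
  rw [Finset.sum_comm]
  refine Finset.sum_congr rfl fun δ _ => Finset.sum_congr rfl fun γ _ => ?_
  rw [Matrix.mul_assoc, Matrix.trace_mul_comm, ← Matrix.mul_assoc, Matrix.trace_mul_comm,
    ← Matrix.mul_assoc]

lemma twirl_apply (h : W ↪ V) (X : Op V d) (σ τ : V → Fin d) :
    twirl h X σ τ = if σ ∘ h = τ ∘ h then
      ∑ δ, X (Function.extend h δ σ) (Function.extend h δ τ) else 0 := by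
  simp only [twirl, Matrix.sum_apply, mul_emb_apply, emb_mul_apply]
  have e1 : ∀ γ δ : W → Fin d, ∀ β : W → Fin d,
      (∑ β', Matrix.single γ δ (1 : ℂ) (σ ∘ h) β' *
        X (Function.extend h β' σ) (Function.extend h β τ)) =
      if γ = σ ∘ h then X (Function.extend h δ σ) (Function.extend h β τ) else 0 := by
    intro γ δ β
    rw [Fintype.sum_eq_single δ]
    · by_cases hγ : γ = σ ∘ h
      · simp [hγ]
      · rw [Matrix.single_apply_of_ne _ _ _ _ _ fun e => hγ e.1, zero_mul, if_neg hγ]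
    · intro β' hβ
      rw [Matrix.single_apply_of_ne _ _ _ _ _ fun e => hβ e.2.symm, zero_mul]
  have e2 : ∀ γ δ : W → Fin d,
      (∑ β, (if γ = σ ∘ h then X (Function.extend h δ σ) (Function.extend h β τ) else 0) *
        Matrix.single δ γ (1 : ℂ) β (τ ∘ h)) =
      if γ = σ ∘ h ∧ γ = τ ∘ h then X (Function.extend h δ σ) (Function.extend h δ τ) else 0 := by
    intro γ δ
    rw [Fintype.sum_eq_single δ]
    · by_cases hγ : γ = τ ∘ h
      · simp [hγ]
      · rw [Matrix.single_apply_of_ne _ _ _ _ _ fun e => hγ e.2, mul_zero,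
          if_neg fun e => hγ e.2]
    · intro β' hβ
      rw [Matrix.single_apply_of_ne _ _ _ _ _ fun e => hβ e.1.symm, mul_zero]
  simp only [e1, e2]
  rw [Fintype.sum_eq_single (σ ∘ h)]
  · by_cases hs : σ ∘ h = τ ∘ h
    · simp [hs]
    · simp [hs]
  · intro γ hγ
    exact Finset.sum_eq_zero fun δ _ => if_neg fun e => hγ e.1

lemma extend_update (h : W ↪ V) (δ : W → Fin d) (σ : V → Fin d) (w : W) (i : Fin d) :
    Function.extend h δ (Function.update σ (h w) i) = Function.extend h δ σ := by
  funext v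
  by_cases hv : v ∈ Set.range h
  · obtain ⟨u, rfl⟩ := hv
    simp [h.injective.extend_apply]
  · rw [extend_off _ _ _ hv, extend_off _ _ _ hv, Function.update_of_ne]
    exact fun e => hv ⟨w, e.symm⟩

lemma update_comp (h : W ↪ V) (σ : V → Fin d) (w : W) (i : Fin d) :
    Function.update σ (h w) i ∘ h = Function.update (σ ∘ h) w i :=
  Function.update_comp_eq_of_injective _ h.injective _ _

lemma twirl_trivialOn_range (h : W ↪ V) (X : Op V d) :
    TrivialOn (Set.range h) (twirl h X) := by
  rintro _ ⟨w, rfl⟩ m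
  ext σ τ
  rw [localAt_mul_apply, mul_localAt_apply, Fintype.sum_eq_single (τ (h w)),
    Fintype.sum_eq_single (σ (h w))]
  · simp only [twirl_apply, extend_update, update_comp]
    rw [mul_comm]
    congr 1
    refine if_congr ?_ rfl rfl
    constructor
    · intro e
      funext u
      by_cases hu : u = w
      · subst hu
        simp
      · simpa [hu] using congrFun e u
    · intro e
      funext u
      by_cases hu : u = w
      · subst hu
        simp
      · simpa [hu] using congrFun e u
  · intro i hi
    rw [twirl_apply, if_neg, zero_mul]
    intro e
    have := congrFun e w
    simp only [Function.comp_apply, Function.update_self] at this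
    exact hi this.symm
  · intro i hi
    rw [twirl_apply, if_neg, mul_zero]
    intro e
    have := congrFun e w
    simp only [Function.comp_apply, Function.update_self] at this
    exact hi this

/-- Needed when the bricks of an edge are treated one at a time: depolarising one does not spoil the
triviality already present elsewhere. -/
lemma twirl_trivialOn {h : W ↪ V} {X : Op V d} {v : V} (hX : TrivialOn {v} X) :
    TrivialOn {v} (twirl h X) := by
  by_cases hv : v ∈ Set.range h
  · exact (twirl_trivialOn_range h X).mono (by simpa using hv)
  · refine TrivialOn.sum _ fun γ _ => TrivialOn.sum _ fun δ _ => ?_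
    have : {v} ⊆ (Set.range h)ᶜ := by simpa using hv
    exact (((trivialOn_emb h _).mono this).mul hX).mul ((trivialOn_emb h _).mono this)

lemma twirl_conj {h : W ↪ V} {A B : Op V d} (hA : TrivialOn (Set.range h) A)
    (hB : TrivialOn (Set.range h) B) (X : Op V d) :
    twirl h (A * X * B) = A * twirl h X * B := by
  simp only [twirl, Finset.mul_sum, Finset.sum_mul]
  refine Finset.sum_congr rfl fun γ _ => Finset.sum_congr rfl fun δ _ => ?_
  simp only [← mul_assoc]
  rw [(hA.commute_emb _).eq]
  simp only [mul_assoc]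
  rw [(hB.commute_emb _).eq]

lemma twirl_emb (f : W ↪ V) (h : W' ↪ W) (B : Op W d) :
    twirl (h.trans f) (emb f B) = emb f (twirl h B) := by
  simp only [twirl, emb_trans, map_sum, map_mul]

end Embedding

/-! ### Traces against local operators -/

section Traces

variable {W V : Type} [Fintype W] [DecidableEq W] [Fintype V] [DecidableEq V] {d : ℕ}

/-- The inclusion of the sites different from `z`. -/
def restEmb (z : W) : {w : W // w ≠ z} ↪ W := Function.Embedding.subtype _

lemma twirl_restEmb (z : W) (B : Op W d) :
    twirl (restEmb z) B = localAt z (ptraceExcept z B) := by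
  ext σ τ
  have hc : σ ∘ restEmb z = τ ∘ restEmb z ↔ ∀ w, w ≠ z → σ w = τ w :=
    ⟨fun h w hw => congrFun h ⟨w, hw⟩, fun h => funext fun w => h w.1 w.2⟩
  have hz : z ∉ Set.range (restEmb z) := fun ⟨w, hw⟩ => w.2 hw
  rw [twirl_apply]
  simp only [hc, localAt]
  refine if_congr Iff.rfl ?_ rfl
  simp only [ptraceExcept]
  rw [← Finset.sum_filter]
  refine Finset.sum_nbij' (fun δ => Function.extend (restEmb z) δ σ) (fun ρ => ρ ∘ restEmb z)
    ?_ ?_ ?_ ?_ ?_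
  · intro δ _
    simp only [Finset.mem_filter, Finset.mem_univ, true_and]
    exact extend_off _ _ _ hz
  · intro ρ _
    exact Finset.mem_univ _
  · intro δ _
    exact extend_comp _ _ _
  · intro ρ hρ
    refine extend_eq_of_agree _ fun v hv => ?_
    have : v = z := by
      by_contra hne
      exact hv ⟨⟨v, hne⟩, rfl⟩
    rw [this]
    exact (Finset.mem_filter.1 hρ).2.symm
  · intro δ _
    congr 1
    funext v
    by_cases hv : v = z
    · subst hv
      rw [Function.update_self, extend_off _ _ _ hz]
    · rw [Function.update_of_ne hv]
      have : v = restEmb z ⟨v, hv⟩ := rfl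
      rw [this, (restEmb z).injective.extend_apply, (restEmb z).injective.extend_apply]

/-- Against an operator that is trivial on all but one site of `f`, an operator supported on `f`
may be replaced by its partial trace. -/
lemma trace_emb_mul {f : W ↪ V} {z : W} {A : Op V d}
    (hA : TrivialOn (f '' {z}ᶜ) A) (B : Op W d) :
    (d : ℂ) ^ (Fintype.card W - 1) * (emb f B * A).trace =
      (localAt (f z) (ptraceExcept z B) * A).trace := by
  have hcard : Fintype.card {w : W // w ≠ z} = Fintype.card W - 1 := by
    simp
  have hA' : TrivialOn (Set.range ((restEmb z).trans f)) A := hA.mono (by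
    rintro _ ⟨w, rfl⟩
    exact ⟨w, w.2, rfl⟩)
  rw [← emb_localAt, ← twirl_restEmb, ← twirl_emb, trace_twirl_mul, twirl_of_trivialOn hA', hcard,
    Matrix.mul_smul, Matrix.trace_smul, smul_eq_mul]

lemma ptraceExcept_localAt_self (v : V) (m : LocalOp d) :
    ptraceExcept v (localAt v m) = (d : ℂ) ^ (Fintype.card V - 1) • m := by
  have h : TrivialOn (Set.range (restEmb v)) (localAt v m) := by
    have := trivialOn_emb (siteEmb v) (m.submatrix (fun s => s ()) (fun s => s ()))
    rw [← localAt_eq_emb] at this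
    refine this.mono ?_
    rintro _ ⟨w, rfl⟩ ⟨u, hu⟩
    exact w.2 hu.symm
  have key := twirl_of_trivialOn h
  rw [twirl_restEmb, ← localAt_smul] at key
  have hcard : Fintype.card {w : V // w ≠ v} = Fintype.card V - 1 := by simp
  rw [hcard] at key
  ext i j
  have := congrFun (congrFun key fun _ => i) (Function.update (fun _ => i) v j)
  have hc : ∀ w, w ≠ v → i = Function.update (fun _ => i) v j w := fun w hw => by
    rw [Function.update_of_ne hw]
  simpa only [localAt, if_pos hc, Function.update_self] using this

lemma trace_ptraceExcept (v : V) (A : Op V d) : (ptraceExcept v A).trace = A.trace := by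
  simp only [Matrix.trace, Matrix.diag, ptraceExcept]
  rw [Finset.sum_comm]
  refine Finset.sum_congr rfl fun σ _ => ?_
  simp

lemma trace_localAt (v : V) (m : LocalOp d) :
    (localAt v m).trace = (d : ℂ) ^ (Fintype.card V - 1) * m.trace := by
  rw [← trace_ptraceExcept v, ptraceExcept_localAt_self, Matrix.trace_smul, smul_eq_mul]

lemma trivialOn_localAt (v : V) (m : LocalOp d) : TrivialOn {v}ᶜ (localAt v m) := by
  rw [localAt_eq_emb]
  refine (trivialOn_emb (siteEmb v) _).mono ?_
  rintro w hw ⟨_, rfl⟩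
  exact hw rfl

/-- `Tr (ptraceExcept z B * m) = Tr (B * m_z)`. -/
lemma trace_ptraceExcept_mul [NeZero d] (z : W) (B : Op W d) (m : LocalOp d) :
    (ptraceExcept z B * m).trace = (B * localAt z m).trace := by
  have h := trace_emb_mul (f := Function.Embedding.refl W) (z := z) (A := localAt z m)
    ((trivialOn_localAt z m).mono (by simp)) B
  have he : emb (Function.Embedding.refl W) B = B := by
    ext σ τ
    rw [emb_apply, if_pos]
    · rfl
    · intro v hv
      exact absurd ⟨v, rfl⟩ hv
  rw [he] at h
  have hd : (d : ℂ) ^ (Fintype.card W - 1) ≠ 0 := pow_ne_zero _ (NeZero.ne _)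
  refine mul_left_cancel₀ hd ?_
  rw [h, ← trace_localAt, localAt_mul]
  rfl

/-- A traceless operator at `v` is orthogonal to everything trivial at `v`. -/
lemma trace_localAt_mul_eq_zero [NeZero d] {v : V} {b : LocalOp d} (hb : b.trace = 0)
    {X : Op V d} (hX : TrivialOn {v} X) : (localAt v b * X).trace = 0 := by
  have hr : TrivialOn (Set.range (siteEmb v)) X := hX.mono (by rintro _ ⟨_, rfl⟩; rfl)
  have h1 := trace_twirl_mul (siteEmb v) (localAt v b) X
  rw [twirl_of_trivialOn hr] at h1
  have h2 : twirl (siteEmb v) (localAt v b) = 0 := by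
    ext σ τ
    rw [twirl_apply]
    split_ifs with h
    · simp only [extend_siteEmb, localAt, Function.update_self]
      by_cases h' : ∀ w, w ≠ v → σ w = τ w
      · refine (Fintype.sum_equiv (Equiv.funUnique Unit (Fin d)) _ (fun i => b i i)
          fun δ => ?_).trans hb
        rw [if_pos]
        · rfl
        · intro w hw
          simp [hw, h' w hw]
      · refine Finset.sum_eq_zero fun δ _ => if_neg fun e => h' fun w hw => ?_
        simpa [hw] using e w hw
    · rfl
  rw [h2, Matrix.zero_mul, Matrix.trace_zero, Matrix.mul_smul, Matrix.trace_smul] at h1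
  exact (smul_eq_zero.1 h1.symm).resolve_left (pow_ne_zero _ (NeZero.ne _))

end Traces

/-! ### Products of gates on disjoint plaquettes -/

section Gates

variable {V I : Type} [Fintype V] [DecidableEq V] [DecidableEq I] {d : ℕ}

open Classical in
/-- The product of the gates `U` on the plaquettes `f i`, `i ∈ T`. -/
def gates (f : I → Plaq ↪ V) (U : Op Plaq d) (T : Finset I) : Op V d := fun σ τ =>
  if ∀ v, (∀ i ∈ T, v ∉ Set.range (f i)) → σ v = τ v then
    ∏ i ∈ T, U (σ ∘ f i) (τ ∘ f i) else 0

variable {f : I → Plaq ↪ V} {U : Op Plaq d}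

lemma gates_empty : gates f U ∅ = 1 := by
  ext σ τ
  simp [gates, Matrix.one_apply, funext_iff]

/-- Disjointness of the plaquettes leaves a single intermediate configuration: `τ` on the new
plaquette, `σ` elsewhere. -/
lemma gates_insert (hf : ∀ i j, i ≠ j → ∀ z w, f i z ≠ f j w) {T : Finset I} {i : I}
    (hi : i ∉ T) : gates f U (insert i T) = emb (f i) U * gates f U T := by
  have hne : ∀ j ∈ T, j ≠ i := fun j hj e => hi (e ▸ hj)
  ext σ τ
  rw [emb_mul_apply, Fintype.sum_eq_single (τ ∘ f i)]
  · have hcomp : ∀ j ∈ T, Function.extend (f i) (τ ∘ f i) σ ∘ f j = σ ∘ f j := fun j hj => by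
      funext w
      exact extend_off _ _ _ fun ⟨z, hz⟩ => hf j i (hne j hj) w z hz.symm
    simp only [gates]
    by_cases h : ∀ v, (∀ j ∈ insert i T, v ∉ Set.range (f j)) → σ v = τ v
    · rw [if_pos h, if_pos, Finset.prod_insert hi]
      · congr 1
        exact Finset.prod_congr rfl fun j hj => by rw [hcomp j hj]
      · intro v hv
        by_cases hvi : v ∈ Set.range (f i)
        · obtain ⟨w, rfl⟩ := hvi
          exact (f i).injective.extend_apply _ _ _
        · rw [extend_off _ _ _ hvi]
          refine h v fun j hj => ?_
          rcases Finset.mem_insert.1 hj with rfl | hj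
          · exact hvi
          · exact hv j hj
    · rw [if_neg h, if_neg, mul_zero]
      intro h'
      refine h fun v hv => ?_
      rw [← h' v fun j hj => hv j (Finset.mem_insert_of_mem hj),
        extend_off _ _ _ (hv i (Finset.mem_insert_self _ _))]
  · intro β hβ
    obtain ⟨w, hw⟩ := Function.ne_iff.1 hβ
    rw [gates, if_neg, mul_zero]
    intro h
    have := h (f i w) fun j hj ⟨z, hz⟩ => hf j i (hne j hj) z w hz
    rw [(f i).injective.extend_apply] at this
    exact hw this

lemma gates_eq_prod [Fintype I] (hsurj : ∀ v, ∃ i z, f i z = v) (σ τ : V → Fin d) :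
    gates f U Finset.univ σ τ = ∏ i, U (σ ∘ f i) (τ ∘ f i) := by
  rw [gates, if_pos]
  intro v hv
  obtain ⟨i, z, hz⟩ := hsurj v
  exact absurd ⟨z, hz⟩ (hv i (Finset.mem_univ i))

variable (hf : ∀ i j, i ≠ j → ∀ z w, f i z ≠ f j w)
include hf

lemma gates_union {T S : Finset I} (h : Disjoint T S) :
    gates f U (T ∪ S) = gates f U T * gates f U S := by
  induction T using Finset.induction_on with
  | empty => rw [Finset.empty_union, gates_empty, one_mul]
  | insert i T hi ih =>
    rw [Finset.disjoint_insert_left] at h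
    rw [Finset.insert_union, gates_insert hf (by simp [hi, h.1]), ih h.2, gates_insert hf hi,
      mul_assoc]

lemma gates_trivialOn (T : Finset I) :
    TrivialOn {v | ∀ i ∈ T, v ∉ Set.range (f i)} (gates f U T) := by
  induction T using Finset.induction_on with
  | empty =>
    rw [gates_empty]
    exact TrivialOn.one _
  | insert i T hi ih =>
    rw [gates_insert hf hi]
    refine TrivialOn.mul ?_ ?_
    · exact (trivialOn_emb (f i) U).mono fun v hv => hv i (Finset.mem_insert_self _ _)
    · exact ih.mono fun v hv j hj => hv j (Finset.mem_insert_of_mem hj)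

lemma gates_trivialOn_range {T : Finset I} {i : I} (hi : i ∉ T) :
    TrivialOn (Set.range (f i)) (gates f U T) :=
  (gates_trivialOn hf T).mono (by
    rintro _ ⟨w, rfl⟩ j hj ⟨z, hz⟩
    exact hf j i (fun e => hi (e ▸ hj)) z w hz)

lemma gates_unitary (h1 : Uᴴ * U = 1) (T : Finset I) :
    (gates f U T)ᴴ * gates f U T = 1 := by
  induction T using Finset.induction_on with
  | empty => simp [gates_empty]
  | insert i T hi ih =>
    rw [gates_insert hf hi, Matrix.conjTranspose_mul, Matrix.mul_assoc,
      ← Matrix.mul_assoc (emb (f i) U)ᴴ, ← emb_conjTranspose, ← map_mul, h1, map_one,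
      Matrix.one_mul, ih]

lemma gates_commute_compl [Fintype I] (T : Finset I) :
    gates f U Finset.univ = gates f U T * gates f U Tᶜ ∧
    gates f U Finset.univ = gates f U Tᶜ * gates f U T := by
  constructor
  · rw [← gates_union hf disjoint_compl_right, Finset.union_compl]
  · rw [← gates_union hf disjoint_compl_left, Finset.union_comm, Finset.union_compl]

end Gates

/-! ### Dual unitarity -/

section Dual

variable {V : Type} [Fintype V] [DecidableEq V] {d : ℕ} [NeZero d]

/-- The two sites of the plaquette with first (`p = 0`) or second (`p = 1`) coordinate `e`. -/
def side (p e : Fin 2) : Fin 2 ↪ Plaq :=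
  if p = 0 then ⟨fun q => (e, q), fun _ _ h => (Prod.ext_iff.1 h).2⟩
  else ⟨fun q => (q, e), fun _ _ h => (Prod.ext_iff.1 h).1⟩

/-- The configuration on the plaquette with given restrictions to two opposite sides. -/
def joint (p e : Fin 2) (γ α : Fin 2 → Fin d) : Plaq → Fin d :=
  -- The default `0` is never read, because the two sides cover the plaquette.
  Function.extend (side p e) γ (Function.extend (side p (1 - e)) α 0)

lemma side_zero (e q : Fin 2) : side 0 e q = (e, q) := rfl

lemma side_one (e q : Fin 2) : side 1 e q = (q, e) := rfl

lemma side_ne (p e q q' : Fin 2) : side p e q ≠ side p (1 - e) q' := by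
  revert p e q q'
  decide

lemma side_cover (p e : Fin 2) (z : Plaq) :
    (∃ q, side p e q = z) ∨ ∃ q, side p (1 - e) q = z := by
  revert p e z
  decide

lemma joint_comp_left (p e : Fin 2) (γ α : Fin 2 → Fin d) : joint p e γ α ∘ side p e = γ :=
  extend_comp _ _ _

lemma joint_comp_right (p e : Fin 2) (γ α : Fin 2 → Fin d) :
    joint p e γ α ∘ side p (1 - e) = α := by
  funext q
  simp only [joint, Function.comp_apply]
  rw [extend_off _ _ _ fun ⟨q', h⟩ => side_ne p e q' q h, (side p _).injective.extend_apply]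

lemma joint_comp_comp (p e : Fin 2) (σ : Plaq → Fin d) :
    joint p e (σ ∘ side p e) (σ ∘ side p (1 - e)) = σ := by
  funext z
  rcases side_cover p e z with ⟨q, rfl⟩ | ⟨q, rfl⟩
  · exact congrFun (joint_comp_left p e _ _) q
  · exact congrFun (joint_comp_right p e _ _) q

/-- The part of the gate on the side `e` for given output `α` and input `β` on the other side. -/
def sideBlock (U : Op Plaq d) (p e : Fin 2) (α β : Fin 2 → Fin d) : Op (Fin 2) d :=
  fun γ δ => U (joint p e γ α) (joint p e δ β)

lemma emb_side_mul_apply (p e : Fin 2) (a b : Op (Fin 2) d) (σ τ : Plaq → Fin d) :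
    (emb (side p e) a * emb (side p (1 - e)) b) σ τ =
      a (σ ∘ side p e) (τ ∘ side p e) * b (σ ∘ side p (1 - e)) (τ ∘ side p (1 - e)) := by
  rw [emb_mul_apply, Fintype.sum_eq_single (τ ∘ side p e)]
  · congr 1
    rw [emb_apply, if_pos]
    · congr 1
      funext q
      exact extend_off _ _ _ fun ⟨q', h⟩ => side_ne p e q' q h
    · intro v hv
      rcases side_cover p e v with ⟨q, rfl⟩ | ⟨q, rfl⟩
      · exact (side p e).injective.extend_apply _ _ _
      · exact absurd ⟨q, rfl⟩ hv
  · intro β hβ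
    obtain ⟨q, hq⟩ := Function.ne_iff.1 hβ
    rw [emb_apply, if_neg, mul_zero]
    intro h
    have := h (side p e q) fun ⟨q', h'⟩ => side_ne p e q q' h'.symm
    rw [(side p e).injective.extend_apply] at this
    exact hq this

lemma eq_sum_sideBlock (U : Op Plaq d) (p e : Fin 2) :
    U = ∑ α, ∑ β, emb (side p e) (sideBlock U p e α β) *
      emb (side p (1 - e)) (Matrix.single α β 1) := by
  ext σ τ
  simp only [Matrix.sum_apply, emb_side_mul_apply]
  rw [Fintype.sum_eq_single (σ ∘ side p (1 - e)), Fintype.sum_eq_single (τ ∘ side p (1 - e))]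
  · simp [sideBlock, joint_comp_comp]
  · intro β hβ
    rw [Matrix.single_apply_of_ne _ _ _ _ _ fun h => hβ h.2, mul_zero]
  · intro α hα
    refine Finset.sum_eq_zero fun β _ => ?_
    rw [Matrix.single_apply_of_ne _ _ _ _ _ fun h => hα h.1, mul_zero]

/-- Contracting the legs of one side of the gate with those of its adjoint leaves the identity on
the legs of the other side. -/
lemma IsTernaryUnitary.sum_sideBlock {U : Op Plaq d} (hU : IsTernaryUnitary U) (p e : Fin 2)
    (γ δ γ' δ' : Fin 2 → Fin d) :
    ∑ α, ∑ β, sideBlock U p e α β γ δ * star (sideBlock U p e α β γ' δ') =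
      if γ = γ' ∧ δ = δ' then 1 else 0 := by
  have hj : ∀ (p e : Fin 2) (c ε : Fin 2 → Fin d) (g : Plaq → Fin d),
      (∀ q, g (side p e q) = c q) → (∀ q, g (side p (1 - e) q) = ε q) → joint p e c ε = g := by
    intro p e c ε g h1 h2
    rw [← joint_comp_comp p e g]
    congr 1
    · exact funext fun q => (h1 q).symm
    · exact funext fun q => (h2 q).symm
  obtain ⟨-, ⟨h1, h1'⟩, h2, h2'⟩ := hU
  have flip : ∀ (p e : Fin 2) (R : Matrix ((Fin 2 → Fin d) × (Fin 2 → Fin d))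
      ((Fin 2 → Fin d) × (Fin 2 → Fin d)) ℂ), Rᴴ * R = 1 →
      (∀ α β γ δ, sideBlock U p e α β γ δ = R (α, β) (γ, δ)) →
      ∑ α, ∑ β, sideBlock U p e α β γ δ * star (sideBlock U p e α β γ' δ') =
        if γ = γ' ∧ δ = δ' then 1 else 0 := by
    intro p e R hR hs
    have := congrFun (congrFun hR (γ', δ')) (γ, δ)
    rw [Matrix.mul_apply, Fintype.sum_prod_type, Matrix.one_apply] at this
    simp only [hs]
    simp only [Prod.mk.injEq] at this
    refine Eq.trans ?_ (this.trans (if_congr (and_congr eq_comm eq_comm) rfl rfl))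
    refine Finset.sum_congr rfl fun α _ => Finset.sum_congr rfl fun β _ => ?_
    rw [Matrix.conjTranspose_apply, mul_comm]
  have hp : ∀ i : Fin 2, i = 0 ∨ i = 1 := by decide
  rcases hp p with rfl | rfl <;> rcases hp e with rfl | rfl
  · refine flip 0 0 (reshape1 U) h1 fun α β γ δ => ?_
    simp only [sideBlock, reshape1]
    congr 1 <;> exact hj _ _ _ _ _ (fun q => by simp [side_zero]) (fun q => by simp [side_zero])
  -- For `e = 1` rows and columns exchange roles, so the other half of unitarity, `R Rᴴ = 1`, is
  -- used in transposed form.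
  · refine flip 0 1 (reshape1 U)ᵀ ?_ fun α β γ δ => ?_
    · rw [← Matrix.transpose_one, ← h1', Matrix.transpose_mul]
      rfl
    · simp only [sideBlock, reshape1, Matrix.transpose_apply]
      congr 1 <;> exact hj _ _ _ _ _ (fun q => by simp [side_zero]) (fun q => by simp [side_zero])
  · refine flip 1 0 (reshape2 U) h2 fun α β γ δ => ?_
    simp only [sideBlock, reshape2]
    congr 1 <;> exact hj _ _ _ _ _ (fun q => by simp [side_one]) (fun q => by simp [side_one])
  · refine flip 1 1 (reshape2 U)ᵀ ?_ fun α β γ δ => ?_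
    · rw [← Matrix.transpose_one, ← h2', Matrix.transpose_mul]
      rfl
    · simp only [sideBlock, reshape2, Matrix.transpose_apply]
      congr 1 <;> exact hj _ _ _ _ _ (fun q => by simp [side_one]) (fun q => by simp [side_one])

/-- Split `U` into blocks on the side `l`, indexed by its legs on `r`. As `X` is trivial on `r`,
tracing out `r` leaves `∑ B X Bᴴ` over the blocks `B`. Expanding the blocks in matrix units of `l`,
the coefficients sum to Kronecker deltas by unitarity across the side, and what remains is exactly
the twirl over `l`. -/
lemma twirl_dual {U : Op Plaq d} (hU : IsTernaryUnitary U) (p e : Fin 2) (f : Plaq ↪ V)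
    {X : Op V d} (hX : TrivialOn (Set.range ((side p (1 - e)).trans f)) X) :
    twirl ((side p (1 - e)).trans f) (emb f U * X * (emb f U)ᴴ) =
      twirl ((side p e).trans f) X := by
  set l := (side p e).trans f with hl
  set r := (side p (1 - e)).trans f with hr
  have hlr : ∀ q q', l q ≠ r q' := fun q q' h => side_ne p e q q' (f.injective h)
  have hcomm : ∀ a b : Op (Fin 2) d, Commute (emb l a) (emb r b) := fun a b =>
    commute_emb_emb hlr a b
  have hG : emb f U = ∑ α, ∑ β, emb l (sideBlock U p e α β) * emb r (Matrix.single α β 1) := by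
    conv_lhs => rw [eq_sum_sideBlock U p e]
    simp only [map_sum, map_mul, emb_trans, hl, hr]
  have hrG : ∀ γ δ : Fin 2 → Fin d, emb r (Matrix.single γ δ 1) * emb f U =
      ∑ β, emb l (sideBlock U p e δ β) * emb r (Matrix.single γ β 1) := by
    intro γ δ
    rw [hG, Finset.mul_sum, Fintype.sum_eq_single δ]
    · rw [Finset.mul_sum]
      refine Finset.sum_congr rfl fun β _ => ?_
      rw [← mul_assoc, ← (hcomm _ _).eq, mul_assoc, ← map_mul, Matrix.single_mul_single_same,
        mul_one]
    · intro α hα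
      rw [Finset.mul_sum]
      refine Finset.sum_eq_zero fun β _ => ?_
      rw [← mul_assoc, ← (hcomm _ _).eq, mul_assoc, ← map_mul,
        Matrix.single_mul_single_of_ne _ _ _ _ hα.symm, map_zero, mul_zero]
  have hGr : ∀ γ δ : Fin 2 → Fin d, (emb f U)ᴴ * emb r (Matrix.single δ γ 1) =
      ∑ β, emb r (Matrix.single β γ 1) * (emb l (sideBlock U p e δ β))ᴴ := by
    intro γ δ
    have h := congrArg Matrix.conjTranspose (hrG γ δ)
    simpa only [Matrix.conjTranspose_mul, Matrix.conjTranspose_sum, ← emb_conjTranspose,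
      Matrix.conjTranspose_single, star_one] using h
  have h1 : twirl r (emb f U * X * (emb f U)ᴴ) =
      ∑ δ, ∑ β, emb l (sideBlock U p e δ β) * X * (emb l (sideBlock U p e δ β))ᴴ := by
    -- The inputs `β`, `β'` on `r` of the gate and of its adjoint must agree, because the matrix
    -- units carrying them meet once `X` has been moved aside.
    have hterm : ∀ γ δ : Fin 2 → Fin d,
        emb r (Matrix.single γ δ 1) * (emb f U * X * (emb f U)ᴴ) * emb r (Matrix.single δ γ 1) =
        (∑ β, emb l (sideBlock U p e δ β) * X * (emb l (sideBlock U p e δ β))ᴴ) *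
          emb r (Matrix.single γ γ 1) := by
      intro γ δ
      have : emb r (Matrix.single γ δ 1) * (emb f U * X * (emb f U)ᴴ) *
          emb r (Matrix.single δ γ 1) = (emb r (Matrix.single γ δ 1) * emb f U) * X *
          ((emb f U)ᴴ * emb r (Matrix.single δ γ 1)) := by
        simp only [mul_assoc]
      rw [this, hrG, hGr, Finset.sum_mul, Finset.sum_mul, Finset.sum_mul]
      refine Finset.sum_congr rfl fun β _ => ?_
      rw [Finset.mul_sum, Fintype.sum_eq_single β]
      · calc emb l (sideBlock U p e δ β) * emb r (Matrix.single γ β 1) * X *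
              (emb r (Matrix.single β γ 1) * (emb l (sideBlock U p e δ β))ᴴ)
            = emb l (sideBlock U p e δ β) * (emb r (Matrix.single γ β 1) * X) *
              emb r (Matrix.single β γ 1) * (emb l (sideBlock U p e δ β))ᴴ := by
              simp only [mul_assoc]
          _ = emb l (sideBlock U p e δ β) * X *
              ((emb r (Matrix.single γ β 1) * emb r (Matrix.single β γ 1)) *
              (emb l (sideBlock U p e δ β))ᴴ) := by
              rw [(hX.commute_emb _).eq]
              simp only [mul_assoc]
          _ = _ := by
              rw [← map_mul, Matrix.single_mul_single_same, mul_one, ← emb_conjTranspose,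
                ← (hcomm _ _).eq]
              simp only [mul_assoc]
      · intro β' hβ
        calc emb l (sideBlock U p e δ β) * emb r (Matrix.single γ β 1) * X *
              (emb r (Matrix.single β' γ 1) * (emb l (sideBlock U p e δ β'))ᴴ)
            = emb l (sideBlock U p e δ β) * (emb r (Matrix.single γ β 1) * X) *
              emb r (Matrix.single β' γ 1) * (emb l (sideBlock U p e δ β'))ᴴ := by
              simp only [mul_assoc]
          _ = emb l (sideBlock U p e δ β) * X *
              ((emb r (Matrix.single γ β 1) * emb r (Matrix.single β' γ 1)) *
              (emb l (sideBlock U p e δ β'))ᴴ) := by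
              rw [(hX.commute_emb _).eq]
              simp only [mul_assoc]
          _ = 0 := by
              rw [← map_mul, Matrix.single_mul_single_of_ne _ _ _ _ hβ.symm, map_zero, zero_mul,
                mul_zero]
    simp only [twirl, hterm]
    rw [Finset.sum_comm]
    refine Finset.sum_congr rfl fun δ _ => ?_
    rw [← Finset.mul_sum, ← map_sum, sum_single_self, map_one, mul_one]
  have hM : ∀ α β : Fin 2 → Fin d, emb l (sideBlock U p e α β) =
      ∑ s : (Fin 2 → Fin d) × (Fin 2 → Fin d),
        sideBlock U p e α β s.1 s.2 • emb l (Matrix.single s.1 s.2 1) := by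
    intro α β
    conv_lhs => rw [Matrix.matrix_eq_sum_single (sideBlock U p e α β)]
    simp only [map_sum, ← map_smul, Matrix.smul_single, smul_eq_mul, mul_one,
      Fintype.sum_prod_type]
  have hMH : ∀ α β : Fin 2 → Fin d, (emb l (sideBlock U p e α β))ᴴ =
      ∑ s : (Fin 2 → Fin d) × (Fin 2 → Fin d),
        star (sideBlock U p e α β s.1 s.2) • emb l (Matrix.single s.2 s.1 1) := by
    intro α β
    rw [hM]
    simp only [Matrix.conjTranspose_sum, Matrix.conjTranspose_smul, ← emb_conjTranspose,
      Matrix.conjTranspose_single, star_one]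
  have h2 : ∀ α β : Fin 2 → Fin d,
      emb l (sideBlock U p e α β) * X * (emb l (sideBlock U p e α β))ᴴ =
      ∑ s : (Fin 2 → Fin d) × (Fin 2 → Fin d), ∑ s' : (Fin 2 → Fin d) × (Fin 2 → Fin d),
        (sideBlock U p e α β s.1 s.2 * star (sideBlock U p e α β s'.1 s'.2)) •
        (emb l (Matrix.single s.1 s.2 1) * X * emb l (Matrix.single s'.2 s'.1 1)) := by
    intro α β
    rw [hMH, hM, Finset.sum_mul, Finset.sum_mul]
    refine Finset.sum_congr rfl fun s _ => ?_
    rw [Finset.mul_sum]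
    refine Finset.sum_congr rfl fun s' _ => ?_
    rw [smul_mul_assoc, smul_mul_assoc, mul_smul_comm, smul_smul]
  have ht : twirl l X = ∑ s : (Fin 2 → Fin d) × (Fin 2 → Fin d),
      emb l (Matrix.single s.1 s.2 1) * X * emb l (Matrix.single s.2 s.1 1) := by
    rw [twirl, Fintype.sum_prod_type]
  rw [h1]
  simp only [h2]
  rw [← Fintype.sum_prod_type' (f := fun α β => ∑ s : (Fin 2 → Fin d) × (Fin 2 → Fin d),
    ∑ s' : (Fin 2 → Fin d) × (Fin 2 → Fin d),
        (sideBlock U p e α β s.1 s.2 * star (sideBlock U p e α β s'.1 s'.2)) •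
        (emb l (Matrix.single s.1 s.2 1) * X * emb l (Matrix.single s'.2 s'.1 1))),
    Finset.sum_comm, ht]
  refine Finset.sum_congr rfl fun s _ => ?_
  rw [Finset.sum_comm, Fintype.sum_eq_single s]
  · rw [← Finset.sum_smul, Fintype.sum_prod_type, hU.sum_sideBlock p e, if_pos ⟨rfl, rfl⟩,
      one_smul]
  · intro s' hs
    rw [← Finset.sum_smul, Fintype.sum_prod_type, hU.sum_sideBlock p e, if_neg, zero_smul]
    exact fun h => hs (Prod.ext h.1.symm h.2.symm)

/-! ### One layer seen from the end of the light cone -/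

variable {I : Type} [DecidableEq I] {f : I → Plaq ↪ V} {U : Op Plaq d}

/-- Moving a row of gates from one side of the light-cone edge to the other. -/
lemma exists_trace_gates_conj (hU : IsTernaryUnitary U)
    (hf : ∀ i j, i ≠ j → ∀ z w, f i z ≠ f j w) (p e : Fin 2) (T : Finset I) :
    ∀ {A X : Op V d},
      (∀ i ∈ T, TrivialOn (Set.range ((side p (1 - e)).trans (f i))) A) →
      (∀ i ∈ T, TrivialOn (Set.range ((side p (1 - e)).trans (f i))) X) →
      ∃ X' : Op V d, (∀ v, TrivialOn {v} X → TrivialOn {v} X') ∧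
        (∀ i ∈ T, TrivialOn (Set.range ((side p e).trans (f i))) X') ∧
        (A * (gates f U T * X * (gates f U T)ᴴ)).trace = (A * X').trace := by
  induction T using Finset.induction_on with
  | empty =>
    intro A X _ _
    exact ⟨X, fun _ h => h, by simp, by simp [gates_empty]⟩
  | insert i T hi ih =>
    intro A X hA hX
    set l := (side p e).trans (f i) with hl
    set r := (side p (1 - e)).trans (f i) with hr
    have hlr : Set.range l ⊆ Set.range (f i) := by
      rintro _ ⟨q, rfl⟩
      exact ⟨_, rfl⟩
    have hrr : Set.range r ⊆ Set.range (f i) := by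
      rintro _ ⟨q, rfl⟩
      exact ⟨_, rfl⟩
    have hd : ((d : ℂ) ^ Fintype.card (Fin 2)) ≠ 0 := pow_ne_zero _ (NeZero.ne _)
    have hG := gates_trivialOn_range hf (U := U) hi
    -- The depolarisation over `l` stands in for the gate at `i`. Its normalisation cancels the
    -- factor that twirling `A` over `r` produces.
    obtain ⟨X', h1, h2, h3⟩ := ih (A := A)
      (X := ((d : ℂ) ^ Fintype.card (Fin 2))⁻¹ • twirl l X)
      (fun j hj => hA j (Finset.mem_insert_of_mem hj))
      (fun j hj v hv => ((twirl_trivialOn ((hX j (Finset.mem_insert_of_mem hj)).mono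
        (Set.singleton_subset_iff.2 hv))).smul _) v rfl)
    have hl' : TrivialOn (Set.range l) X' := fun v hv => h1 v
      (((twirl_trivialOn_range l X).mono (Set.singleton_subset_iff.2 hv)).smul _) v rfl
    refine ⟨X', fun v hv => h1 v ((twirl_trivialOn hv).smul _), ?_, ?_⟩
    · intro j hj
      rcases Finset.mem_insert.1 hj with rfl | hj
      · exact hl'
      · exact h2 j hj
    · rw [← h3]
      set G := gates f U T with hGdef
      have hY : TrivialOn (Set.range r) (G * X * Gᴴ) :=
        ((hG.mono hrr).mul (hX i (Finset.mem_insert_self _ _))).mul (hG.mono hrr).conjTranspose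
      have key : twirl r (emb (f i) U * (G * X * Gᴴ) * (emb (f i) U)ᴴ) = G * twirl l X * Gᴴ := by
        rw [twirl_dual hU p e (f i) hY, twirl_conj (hG.mono hlr) (hG.mono hlr).conjTranspose]
      have hAr := twirl_of_trivialOn (hA i (Finset.mem_insert_self _ _))
      have hB : gates f U (insert i T) * X * (gates f U (insert i T))ᴴ =
          emb (f i) U * (G * X * Gᴴ) * (emb (f i) U)ᴴ := by
        rw [gates_insert hf hi, Matrix.conjTranspose_mul]
        simp only [mul_assoc]
        rfl
      have ht := trace_twirl_mul r A (emb (f i) U * (G * X * Gᴴ) * (emb (f i) U)ᴴ)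
      rw [key, hAr, Matrix.smul_mul, Matrix.trace_smul, smul_eq_mul] at ht
      rw [hB, mul_smul_comm, smul_mul_assoc, mul_smul_comm, Matrix.trace_smul, ← ht, smul_eq_mul,
        inv_mul_cancel_left₀ hd]

variable [Fintype I]

/-- The support of an operator grows by at most one plaquette in a layer. -/
lemma trivialOn_gates_conj (h1 : Uᴴ * U = 1)
    (hf : ∀ i j, i ≠ j → ∀ z w, f i z ≠ f j w) {A : Op V d} {i : I}
    (hA : TrivialOn (Set.range (f i)) A) :
    TrivialOn (Set.range (f i))
      ((gates f U Finset.univ)ᴴ * A * gates f U Finset.univ) := by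
  have hG : TrivialOn (Set.range (f i)) (gates f U ({i}ᶜ : Finset I)) :=
    gates_trivialOn_range hf (by simp)
  have hi : gates f U {i} = emb (f i) U := by
    have := gates_insert (f := f) (U := U) hf (T := ∅) (i := i) (by simp)
    simpa [gates_empty] using this
  -- The gate at `i` commutes with `A` and cancels against its adjoint; the other gates do not touch
  -- this plaquette.
  have e : (gates f U Finset.univ)ᴴ * A * gates f U Finset.univ =
      (gates f U ({i}ᶜ : Finset I))ᴴ * A * gates f U ({i}ᶜ : Finset I) := by
    rw [(gates_commute_compl hf {i}).1, hi, Matrix.conjTranspose_mul]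
    calc _ = (gates f U ({i}ᶜ : Finset I))ᴴ * (emb (f i) U)ᴴ * (A * emb (f i) U) *
          gates f U ({i}ᶜ : Finset I) := by simp only [mul_assoc]
      _ = (gates f U ({i}ᶜ : Finset I))ᴴ * ((emb (f i) U)ᴴ * emb (f i) U) * A *
          gates f U ({i}ᶜ : Finset I) := by
          rw [← (hA.commute_emb U).eq]
          simp only [mul_assoc]
      _ = _ := by
          rw [← emb_conjTranspose, ← map_mul, h1, map_one, mul_one]
  rw [e]
  exact (hG.conjTranspose.mul hA).mul hG

/-- Pulling a local observable through one layer when the evolved operator meets the plaquette of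
the observable only in the site `z`. -/
lemma trace_localAt_gates_conj (h1 : Uᴴ * U = 1)
    (hf : ∀ i j, i ≠ j → ∀ z w, f i z ≠ f j w) {A : Op V d} {i : I} {z : Plaq}
    (hA : TrivialOn (f i '' {z}ᶜ) A) (w : Plaq) (a : LocalOp d) :
    (d : ℂ) ^ 3 * (localAt (f i w) a *
      ((gates f U Finset.univ)ᴴ * A * gates f U Finset.univ)).trace =
    (localAt (f i z) (ptraceExcept z (U * localAt w a * Uᴴ)) * A).trace := by
  have hG : TrivialOn (Set.range (f i)) (gates f U ({i}ᶜ : Finset I)) :=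
    gates_trivialOn_range hf (by simp)
  have hi : gates f U {i} = emb (f i) U := by
    have := gates_insert (f := f) (U := U) hf (T := ∅) (i := i) (by simp)
    simpa [gates_empty] using this
  have hGu : gates f U ({i}ᶜ : Finset I) * (gates f U ({i}ᶜ : Finset I))ᴴ = 1 :=
    mul_eq_one_comm.1 (gates_unitary hf h1 _)
  -- Seen from the observable, every gate except that on its own plaquette cancels.
  have e : gates f U Finset.univ * localAt (f i w) a * (gates f U Finset.univ)ᴴ =
      emb (f i) (U * localAt w a * Uᴴ) := by
    rw [(gates_commute_compl hf {i}).1, hi, Matrix.conjTranspose_mul]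
    calc _ = emb (f i) U * (gates f U ({i}ᶜ : Finset I) * localAt (f i w) a) *
          (gates f U ({i}ᶜ : Finset I))ᴴ * (emb (f i) U)ᴴ := by simp only [mul_assoc]
      _ = emb (f i) U * localAt (f i w) a *
          (gates f U ({i}ᶜ : Finset I) * (gates f U ({i}ᶜ : Finset I))ᴴ) * (emb (f i) U)ᴴ := by
          rw [← (hG (f i w) ⟨w, rfl⟩ a).eq]
          simp only [mul_assoc]
      _ = _ := by
          rw [hGu, mul_one, map_mul, map_mul, emb_localAt, emb_conjTranspose]
  have hc : (localAt (f i w) a *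
      ((gates f U Finset.univ)ᴴ * A * gates f U Finset.univ)).trace =
      (emb (f i) (U * localAt w a * Uᴴ) * A).trace := by
    rw [← e, ← mul_assoc, Matrix.trace_mul_comm]
    simp only [mul_assoc]
  have hcard : Fintype.card Plaq - 1 = 3 := by simp [Plaq]
  rw [hc, ← trace_emb_mul hA, hcard]

/-- One layer moves the edge of the light cone by one column. -/
lemma edge_gates_conj (hU : IsTernaryUnitary U)
    (hf : ∀ i j, i ≠ j → ∀ z w, f i z ≠ f j w) (p e : Fin 2) (T : Finset I) {C C' : Set V}
    (hC : ∀ v, v ∈ C → ∃ i ∈ T, v ∈ Set.range ((side p e).trans (f i)))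
    (hC' : ∀ v, v ∈ C' ↔ ∃ i ∈ T, v ∈ Set.range ((side p (1 - e)).trans (f i)))
    {A : Op V d} (hA : TrivialOn C' A)
    (h0 : ∀ X, TrivialOn C X → (A * X).trace = 0) {X : Op V d} (hX : TrivialOn C' X) :
    (((gates f U Finset.univ)ᴴ * A * gates f U Finset.univ) * X).trace = 0 := by
  -- Gates away from the edge act first. They do not touch the plaquettes of `T`, so triviality on
  -- the outer sides survives.
  set Y := gates f U Tᶜ * X * (gates f U Tᶜ)ᴴ with hYdef
  have hsub : ∀ i ∈ T, Set.range ((side p (1 - e)).trans (f i)) ⊆ C' := fun i hi v hv =>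
    (hC' v).2 ⟨i, hi, hv⟩
  have hsub' : ∀ i, Set.range ((side p (1 - e)).trans (f i)) ⊆ Set.range (f i) := by
    rintro i _ ⟨q, rfl⟩
    exact ⟨_, rfl⟩
  have hY : ∀ i ∈ T, TrivialOn (Set.range ((side p (1 - e)).trans (f i))) Y := fun i hi => by
    have hG : TrivialOn (Set.range ((side p (1 - e)).trans (f i))) (gates f U Tᶜ) :=
      (gates_trivialOn_range hf (by simpa using hi)).mono (hsub' i)
    exact (hG.mul (hX.mono (hsub i hi))).mul hG.conjTranspose
  obtain ⟨X', -, h2, h3⟩ := exists_trace_gates_conj hU hf p e T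
    (fun i hi => hA.mono (hsub i hi)) hY
  have hX' : TrivialOn C X' := fun v hv => by
    obtain ⟨i, hi, hv'⟩ := hC v hv
    exact h2 i hi v hv'
  rw [← h0 X' hX', ← h3, hYdef]
  have e : gates f U T * (gates f U Tᶜ * X * (gates f U Tᶜ)ᴴ) * (gates f U T)ᴴ =
      gates f U Finset.univ * X * (gates f U Finset.univ)ᴴ := by
    rw [(gates_commute_compl hf T).1, Matrix.conjTranspose_mul]
    simp only [mul_assoc]
  rw [e, mul_assoc, mul_assoc, Matrix.trace_mul_comm]
  simp only [mul_assoc]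

end Dual

/-! ### Geometry of the brickwork -/

section Geometry

variable {L : ℕ} [NeZero L]

/-- The coordinate at position `e` of the `i`-th brick, in one direction. -/
def brickCoord (L s : ℕ) (i : Fin (L / 2)) (e : Fin 2) : ZMod L :=
  ((2 * i + s : ℕ) : ZMod L) + ((e : ℕ) : ZMod L)

lemma brickCoord_injective (s : ℕ) {i j : Fin (L / 2)} {e e' : Fin 2}
    (h : brickCoord L s i e = brickCoord L s j e') : i = j ∧ e = e' := by
  have h' : ((2 * (i : ℕ) + e : ℕ) : ZMod L) = ((2 * (j : ℕ) + e' : ℕ) : ZMod L) := by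
    simp only [brickCoord] at h
    push_cast at h ⊢
    linear_combination h
  rw [ZMod.natCast_eq_natCast_iff', Nat.mod_eq_of_lt (by omega), Nat.mod_eq_of_lt (by omega)] at h'
  constructor <;> ext <;> omega

lemma brickCoord_surjective (hL : Even L) (s : ℕ) (u : ZMod L) :
    ∃ i e, brickCoord L s i e = u := by
  have hb : Function.Bijective (fun q : Fin (L / 2) × Fin 2 => brickCoord L s q.1 q.2) := by
    rw [Fintype.bijective_iff_injective_and_card]
    refine ⟨fun q q' h => ?_, ?_⟩
    · obtain ⟨h1, h2⟩ := brickCoord_injective s h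
      exact Prod.ext h1 h2
    · simp only [Fintype.card_prod, Fintype.card_fin, ZMod.card]
      obtain ⟨m, rfl⟩ := hL
      omega
  obtain ⟨⟨i, e⟩, h⟩ := hb.2 u
  exact ⟨i, e, h⟩

/-- The parity of the layer that is applied after `k` layers. -/
def layerShift (k : ℕ) : ℕ := (k + 1) % 2

/-- The ray coordinate and the brick anchors both change parity from layer to layer, so the position
inside the brick depends only on the parity of `c`. A step in direction `rayDir c` then leads to the
other end of the same brick. -/
lemma exists_brickCoord_ray (hL : Even L) (k : ℕ) (c : ZMod L) :
    ∃ i, c + (k : ZMod L) * rayDir c =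
        brickCoord L (layerShift k) i (if Even c.val then 1 else 0) ∧
      c + ((k + 1 : ℕ) : ZMod L) * rayDir c =
        brickCoord L (layerShift k) i (1 - if Even c.val then 1 else 0) := by
  obtain ⟨i, e, h⟩ := brickCoord_surjective hL (layerShift k) (c + (k : ZMod L) * rayDir c)
  have h2 : 2 ∣ L := hL.two_dvd
  have hk : ((layerShift k : ℕ) : ZMod 2) = k + 1 := by
    rw [layerShift, ZMod.natCast_mod]
    push_cast
    rfl
  have hdir : ZMod.castHom h2 (ZMod 2) (rayDir c) = 1 := by
    rw [rayDir]
    split_ifs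
    · rw [map_neg, map_one]
      decide
    · rw [map_one]
  have hc : ZMod.castHom h2 (ZMod 2) c = ((c.val : ℕ) : ZMod 2) := by
    conv_lhs => rw [← ZMod.natCast_zmod_val c]
    rw [map_natCast]
  have htwo : (2 : ZMod 2) = 0 := by decide
  -- Modulo 2, which makes sense because `L` is even, `c + k = (k + 1) + e`.
  have hpar : ((e : ℕ) : ZMod 2) = ((c.val + 1 : ℕ) : ZMod 2) := by
    have := congrArg (ZMod.castHom h2 (ZMod 2)) h
    simp only [brickCoord, map_add, map_mul, map_natCast, hdir, hc] at this
    push_cast at this ⊢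
    rw [hk] at this
    linear_combination this - (i + 1 : ZMod 2) * htwo
  rw [ZMod.natCast_eq_natCast_iff'] at hpar
  have hs : c + ((k + 1 : ℕ) : ZMod L) * rayDir c = c + (k : ZMod L) * rayDir c + rayDir c := by
    push_cast
    ring
  have he : e = 0 ∨ e = 1 := by
    revert e
    intro e _ _
    fin_cases e <;> simp
  refine ⟨i, ?_, ?_⟩
  · rw [← h]
    congr 1
    split_ifs with hev
    · obtain ⟨m, hm⟩ := hev
      rcases he with rfl | rfl
      · simp only [Fin.val_zero] at hpar
        omega
      · rfl
    · rw [Nat.not_even_iff] at hev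
      rcases he with rfl | rfl
      · rfl
      · simp only [Fin.val_one] at hpar
        omega
  · rw [hs, ← h]
    by_cases hev : Even c.val
    · have he1 : e = 1 := by
        obtain ⟨m, hm⟩ := hev
        rcases he with rfl | rfl
        · simp only [Fin.val_zero] at hpar
          omega
        · rfl
      rw [if_pos hev, rayDir, if_pos hev, he1]
      simp [brickCoord]
    · have he0 : e = 0 := by
        rw [Nat.not_even_iff] at hev
        rcases he with rfl | rfl
        · rfl
        · simp only [Fin.val_one] at hpar
          omega
      rw [if_neg hev, rayDir, if_neg hev, he0]
      simp [brickCoord]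

/-- The coordinate `u` is at distance at most `k` from `c`. -/
def Near (k : ℕ) (c u : ZMod L) : Prop := ∃ j : ℤ, |j| ≤ k ∧ u = c + j

/-- The integer `k + 1 ± j` lies between 1 and `2k + 1 < L`, hence is nonzero modulo `L`. -/
lemma not_near_ray {k : ℕ} (hk : 2 * (k + 1) ≤ L) (c : ZMod L) :
    ¬ Near k c (c + ((k + 1 : ℕ) : ZMod L) * rayDir c) := by
  rintro ⟨j, hj, h⟩
  have key : ∀ m : ℤ, ((m : ℤ) : ZMod L) = 0 → |m| < L → m = 0 := fun m hm hlt => by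
    rw [ZMod.intCast_zmod_eq_zero_iff_dvd] at hm
    exact Int.eq_zero_of_abs_lt_dvd hm hlt
  rw [abs_le] at hj
  rw [rayDir] at h
  split_ifs at h
  · have := key (k + 1 + j) (by push_cast at h ⊢; linear_combination -h)
      (by rw [abs_lt]; omega)
    omega
  · have := key (k + 1 - j) (by push_cast at h ⊢; linear_combination h)
      (by rw [abs_lt]; omega)
    omega

lemma near_brickCoord {s k : ℕ} {c : ZMod L} {i : Fin (L / 2)} {e e' : Fin 2}
    (h : Near k c (brickCoord L s i e)) : Near (k + 1) c (brickCoord L s i e') := by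
  obtain ⟨j, hj, h⟩ := h
  rw [abs_le] at hj
  refine ⟨j + (e' : ℕ) - (e : ℕ), ?_, ?_⟩
  · rw [abs_le]
    push_cast
    omega
  · simp only [brickCoord] at h ⊢
    push_cast at h ⊢
    linear_combination h

lemma cycDist_ray {t : ℕ} (ht : 4 * t ≤ L) (c : ZMod L) :
    cycDist (c + ((2 * t : ℕ) : ZMod L) * rayDir c) c = 2 * t := by
  have h : ((2 * t : ℕ) : ZMod L).valMinAbs.natAbs = 2 * t := by
    rw [ZMod.valMinAbs_natCast_of_le_half (by omega), Int.natAbs_natCast]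
  rw [cycDist, add_sub_cancel_left, rayDir]
  split_ifs
  · rw [mul_neg, mul_one, ZMod.natAbs_valMinAbs_neg, h]
  · rw [mul_one, h]

/-- The plaquettes of the layer with shift `s`. -/
def brick (L s : ℕ) [NeZero L] (i : Fin (L / 2) × Fin (L / 2)) : Plaq ↪ Site L :=
  ⟨fun z => (brickCoord L s i.1 z.1, brickCoord L s i.2 z.2), fun z w h => by
    obtain ⟨h1, h2⟩ := Prod.ext_iff.1 h
    exact Prod.ext (brickCoord_injective s h1).2 (brickCoord_injective s h2).2⟩

lemma brick_disjoint (s : ℕ) (i j : Fin (L / 2) × Fin (L / 2)) (hij : i ≠ j) (z w : Plaq) :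
    brick L s i z ≠ brick L s j w := fun h => by
  obtain ⟨h1, h2⟩ := Prod.ext_iff.1 h
  exact hij (Prod.ext (brickCoord_injective s h1).1 (brickCoord_injective s h2).1)

lemma brick_cover (hL : Even L) (s : ℕ) (v : Site L) : ∃ i z, brick L s i z = v := by
  obtain ⟨i, e, h⟩ := brickCoord_surjective hL s v.1
  obtain ⟨j, e', h'⟩ := brickCoord_surjective hL s v.2
  exact ⟨(i, j), (e, e'), Prod.ext h h'⟩

lemma layer_eq_gates {d : ℕ} (hL : Even L) (s : ℕ) (U : Op Plaq d) :
    layer L s U = gates (brick L s) U Finset.univ := by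
  ext σ τ
  rw [gates_eq_prod (brick_cover hL s), Fintype.prod_prod_type]
  rfl

/-- The site reached from `y` after `k` layers along the light ray. -/
def raySite (y : Site L) (k : ℕ) : Site L :=
  (y.1 + (k : ZMod L) * rayDir y.1, y.2 + (k : ZMod L) * rayDir y.2)

lemma exists_brick_ray (hL : Even L) (y : Site L) (k : ℕ) :
    ∃ i, raySite y k = brick L (layerShift k) i (posInOdd y) ∧
      raySite y (k + 1) = brick L (layerShift k) i (opp (posInOdd y)) := by
  obtain ⟨i, h1, h2⟩ := exists_brickCoord_ray hL k y.1
  obtain ⟨j, h3, h4⟩ := exists_brickCoord_ray hL k y.2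
  exact ⟨(i, j), Prod.ext h1 h3, Prod.ext h2 h4⟩

end Geometry

/-! ### Heisenberg evolution layer by layer -/

section Evolution

variable {L : ℕ} [NeZero L] {d : ℕ} [NeZero d] {U : Op Plaq d}

/-- The operator `b_y` evolved through `k` layers. -/
def evolved (L : ℕ) [NeZero L] (U : Op Plaq d) (b : LocalOp d) (y : Site L) : ℕ → Op (Site L) d
  | 0 => localAt y b
  | k + 1 => (layer L (layerShift k) U)ᴴ * evolved L U b y k * layer L (layerShift k) U

lemma timeStep_unitary (hL : Even L) (h1 : Uᴴ * U = 1) :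
    (timeStep L U)ᴴ * timeStep L U = 1 := by
  have h : ∀ s, (layer L s U)ᴴ * layer L s U = 1 := fun s => by
    rw [layer_eq_gates hL]
    exact gates_unitary (brick_disjoint s) h1 _
  rw [timeStep, Matrix.conjTranspose_mul, Matrix.mul_assoc, ← Matrix.mul_assoc _ᴴ (layer L 1 U), h,
    Matrix.one_mul, h]

/-- In `𝕌⁻¹ b 𝕌` with `𝕌 = 𝕌_oo 𝕌_ee`, the observable meets `𝕌_oo` first; this is why even `k` has
shift 1. -/
lemma evolved_two_mul (b : LocalOp d) (y : Site L) (t : ℕ) :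
    evolved L U b y (2 * t) = ((timeStep L U)ᴴ) ^ t * localAt y b * timeStep L U ^ t := by
  induction t with
  | zero => simp [evolved]
  | succ t ih =>
    have e0 : layerShift (2 * t) = 1 := by
      unfold layerShift
      omega
    have e1 : layerShift (2 * t + 1) = 0 := by
      unfold layerShift
      omega
    rw [show 2 * (t + 1) = 2 * t + 1 + 1 by ring, evolved, evolved, e0, e1, ih, pow_succ',
      pow_succ]
    simp only [timeStep, Matrix.conjTranspose_mul, Matrix.mul_assoc]

lemma correlation_eq (hL : Even L) (h1 : Uᴴ * U = 1) (a b : LocalOp d) (x y : Site L) (t : ℕ) :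
    correlation L U a b x y t =
      (1 / (d : ℂ) ^ (L ^ 2)) * (localAt x a * evolved L U b y (2 * t)).trace := by
  have hinv : (timeStep L U)⁻¹ = (timeStep L U)ᴴ :=
    Matrix.inv_eq_left_inv (timeStep_unitary hL h1)
  rw [correlation, evolved_two_mul, Matrix.zpow_neg_natCast, zpow_natCast, ← Matrix.inv_pow', hinv]
  simp only [Matrix.mul_assoc]

lemma evolved_trivialOn (hL : Even L) (h1 : Uᴴ * U = 1) (b : LocalOp d) (y : Site L) (k : ℕ) :
    TrivialOn {v | ¬ (Near k y.1 v.1 ∧ Near k y.2 v.2)} (evolved L U b y k) := by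
  induction k with
  | zero =>
    refine (trivialOn_localAt y b).mono ?_
    rintro v hv rfl
    exact hv ⟨⟨0, by simp, by simp⟩, ⟨0, by simp, by simp⟩⟩
  | succ k ih =>
    intro v hv
    obtain ⟨i, z, rfl⟩ := brick_cover hL (layerShift k) v
    rw [evolved, layer_eq_gates hL]
    refine trivialOn_gates_conj h1 (brick_disjoint (layerShift k)) (i := i) (ih.mono ?_) _ ⟨z, rfl⟩
    rintro _ ⟨w, rfl⟩ ⟨hw1, hw2⟩
    exact hv ⟨near_brickCoord hw1, near_brickCoord hw2⟩

/-- Identifies the trace adjoint of `M_z` with the partial trace that arises when a layer is moved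
onto the observable. -/
lemma trace_channelM_mul (z : Plaq) (x a : LocalOp d) :
    (d : ℂ) ^ 3 * (channelM U z x * a).trace =
      (x * ptraceExcept z (U * localAt (opp z) a * Uᴴ)).trace := by
  have hd : (d : ℂ) ^ 3 ≠ 0 := pow_ne_zero _ (NeZero.ne _)
  change (d : ℂ) ^ 3 * (((1 / (d : ℂ) ^ 3) • ptraceExcept (opp z) (Uᴴ * localAt z x * U)) * a).trace
    = _
  rw [Matrix.smul_mul, Matrix.trace_smul, smul_eq_mul, ← mul_assoc, mul_one_div_cancel hd, one_mul,
    trace_ptraceExcept_mul, Matrix.trace_mul_comm x, trace_ptraceExcept_mul]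
  rw [Matrix.mul_assoc, Matrix.mul_assoc, Matrix.trace_mul_comm, Matrix.mul_assoc,
    Matrix.trace_mul_comm]

/-- The induction is over all `a`: removing a layer replaces `a` by its image under the adjoint of
`M_z`. -/
lemma trace_ray (hL : Even L) (h1 : Uᴴ * U = 1) (b : LocalOp d) (y : Site L) (k : ℕ)
    (hk : 2 * k ≤ L) (a : LocalOp d) :
    (localAt (raySite y k) a * evolved L U b y k).trace =
      (d : ℂ) ^ (L ^ 2 - 1) * ((channelM U (posInOdd y) ^ k) b * a).trace := by
  induction k generalizing a with
  | zero =>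
    have hy : raySite y 0 = y := by simp [raySite]
    have hcard : Fintype.card (Site L) = L ^ 2 := by
      rw [Fintype.card_prod, ZMod.card, sq]
    rw [hy, evolved, ← localAt_mul, trace_localAt, hcard, pow_zero, Module.End.one_apply,
      Matrix.trace_mul_comm a]
  | succ k ih =>
    have hd : (d : ℂ) ^ 3 ≠ 0 := pow_ne_zero _ (NeZero.ne _)
    obtain ⟨i, hi, hi'⟩ := exists_brick_ray hL y k
    refine mul_left_cancel₀ hd ?_
    rw [hi', evolved, layer_eq_gates hL, trace_localAt_gates_conj h1 (brick_disjoint (layerShift k))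
      (z := posInOdd y), ← hi, ih (by omega), mul_left_comm, pow_succ' (channelM _ _), Module.End.mul_apply,
      trace_channelM_mul]
    refine (evolved_trivialOn hL h1 b y k).mono ?_
    rintro _ ⟨w, hw, rfl⟩ ⟨hn1, hn2⟩
    -- A site of the brick other than the current ray site shares a coordinate with the next one,
    -- and the cone does not reach that coordinate.
    have hfin : ∀ e e' : Fin 2, e ≠ e' → e = 1 - e' := by decide
    by_cases hw1 : w.1 = (posInOdd y).1
    · have hw2 : w.2 ≠ (posInOdd y).2 := fun h => hw (Prod.ext hw1 h)
      refine not_near_ray hk y.2 ?_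
      have e2 : y.2 + ((k + 1 : ℕ) : ZMod L) * rayDir y.2 = (brick L (layerShift k) i w).2 := by
        refine (congrArg Prod.snd hi').trans ?_
        exact congrArg (brickCoord L (layerShift k) i.2) (hfin _ _ hw2).symm
      rw [e2]
      exact hn2
    · refine not_near_ray hk y.1 ?_
      have e1 : y.1 + ((k + 1 : ℕ) : ZMod L) * rayDir y.1 = (brick L (layerShift k) i w).1 := by
        refine (congrArg Prod.fst hi').trans ?_
        exact congrArg (brickCoord L (layerShift k) i.1) (hfin _ _ hw1).symm
      rw [e1]
      exact hn1

/-- The component of a pair in direction `p`. -/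
def component {α : Type} (p : Fin 2) (x : α × α) : α := if p = 0 then x.1 else x.2

lemma component_brick (p : Fin 2) (s : ℕ) (i : Fin (L / 2) × Fin (L / 2)) (z : Plaq) :
    component p (brick L s i z) = brickCoord L s (component p i) (component p z) := by
  unfold component
  split_ifs <;> rfl

lemma component_eq_iff (p e : Fin 2) (z : Plaq) :
    component p z = e ↔ z ∈ Set.range (side p e) := by
  simp only [Set.mem_range]
  unfold component
  revert p e z
  decide

/-- Arbitrary `X` trivial on the edge column is what makes the induction close: pulling the local
`a_x` back through a layer does not keep it local, but triviality on the edge persists. -/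
lemma trace_off_ray (hL : Even L) (hU : IsTernaryUnitary U) {b : LocalOp d} (hb : b.trace = 0)
    (y : Site L) (p : Fin 2) (k : ℕ) (hk : 2 * k ≤ L) {X : Op (Site L) d}
    (hX : TrivialOn {v | component p v = component p (raySite y k)} X) :
    (evolved L U b y k * X).trace = 0 := by
  induction k generalizing X with
  | zero =>
    refine trace_localAt_mul_eq_zero hb (hX.mono ?_)
    rintro _ rfl
    simp [raySite]
  | succ k ih =>
    obtain ⟨i, hi, hi'⟩ := exists_brick_ray hL y k
    have hmem : ∀ (e : Fin 2) (v : Site L),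
        component p v = brickCoord L (layerShift k) (component p i) e ↔
        ∃ j ∈ Finset.univ.filter (fun j => component p j = component p i),
          v ∈ Set.range ((side p e).trans (brick L (layerShift k) j)) := by
      intro e v
      constructor
      · intro h
        obtain ⟨j, w, rfl⟩ := brick_cover hL (layerShift k) v
        rw [component_brick] at h
        obtain ⟨hj, hw⟩ := brickCoord_injective _ h
        obtain ⟨q, rfl⟩ := (component_eq_iff p e w).1 hw
        exact ⟨j, by simpa using hj, q, rfl⟩
      · rintro ⟨j, hj, q, rfl⟩
        have hj' : component p j = component p i := by simpa using hj
        have hq : component p (side p e q) = e := (component_eq_iff p e _).2 ⟨q, rfl⟩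
        rw [Function.Embedding.trans_apply, component_brick, hj', hq]
    have hopp : component p (opp (posInOdd y)) = 1 - component p (posInOdd y) := by
      unfold component opp
      split_ifs <;> rfl
    rw [evolved, layer_eq_gates hL]
    refine edge_gates_conj hU (brick_disjoint (layerShift k)) p (component p (posInOdd y))
      (Finset.univ.filter (fun j => component p j = component p i))
      (C := {v | component p v = component p (raySite y k)})
      (C' := {v | component p v = component p (raySite y (k + 1))}) ?_ ?_ ?_
      (fun X hX => ih (by omega) hX) hX
    · intro v hv
      refine (hmem _ v).1 ?_
      rw [← component_brick, ← hi]
      exact hv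
    · intro v
      rw [← hmem, ← hopp, ← component_brick, ← hi']
      rfl
    · refine (evolved_trivialOn hL hU.1.1 b y k).mono ?_
      rintro v hv ⟨hn1, hn2⟩
      simp only [Set.mem_ofPred_eq, component] at hv
      split_ifs at hv
      · rw [hv] at hn1
        exact not_near_ray hk y.1 hn1
      · rw [hv] at hn2
        exact not_near_ray hk y.2 hn2

lemma onLightRay_iff {t : ℕ} {x y : Site L} : OnLightRay t x y ↔ x = raySite y (2 * t) :=
  (Prod.ext_iff (x := x) (y := raySite y (2 * t))).symm

lemma correlation_off_ray (hL : Even L) (hU : IsTernaryUnitary U) {t : ℕ} (ht : 4 * t ≤ L)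
    (a : LocalOp d) {b : LocalOp d} (hb : b.trace = 0) {x y : Site L} (h : ¬ OnLightRay t x y) :
    correlation L U a b x y t = 0 := by
  have hp : ∃ p, component p x ≠ component p (raySite y (2 * t)) := by
    by_contra! hcon
    exact h (onLightRay_iff.2 (Prod.ext (hcon 0) (hcon 1)))
  obtain ⟨p, hp⟩ := hp
  rw [correlation_eq hL hU.1.1, Matrix.trace_mul_comm,
    trace_off_ray hL hU hb y p (2 * t) (by omega), mul_zero]
  refine (trivialOn_localAt x a).mono ?_
  rintro v hv rfl
  exact hp hv

lemma correlation_on_ray (hL : Even L) (hU : IsTernaryUnitary U) {t : ℕ} (ht : 4 * t ≤ L)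
    (a b : LocalOp d) {x y : Site L} (h : OnLightRay t x y) :
    correlation L U a b x y t =
      (1 / (d : ℂ)) * ((channelM U (posInOdd y) ^ (2 * t)) b * a).trace := by
  have hd : (d : ℂ) ≠ 0 := NeZero.ne _
  have hpow : (d : ℂ) ^ (L ^ 2) = d ^ (L ^ 2 - 1) * d := by
    rw [← pow_succ, Nat.sub_add_cancel]
    exact Nat.one_le_iff_ne_zero.2 (pow_ne_zero _ (NeZero.ne L))
  rw [correlation_eq hL hU.1.1, onLightRay_iff.1 h, trace_ray hL hU.1.1 b y (2 * t) (by omega),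
    hpow]
  field_simp

end Evolution

/-! ### The single-site map is a unital channel -/

section Channel

variable {V : Type} [Fintype V] [DecidableEq V] {d : ℕ}

/-- Overwriting the value at `v` is `d`-to-one onto the configurations with value `i` there. -/
lemma sum_comp_update (v : V) (i : Fin d) (G : (V → Fin d) → ℂ) :
    ∑ η : V → Fin d, G (Function.update η v i) =
      d * ∑ η : V → Fin d, if η v = i then G η else 0 := by
  have hs : ∀ (m : Fin d) (ρ : {w // w ≠ v} → Fin d),
      Function.update ((Equiv.funSplitAt v (Fin d)).symm (m, ρ)) v i =
        (Equiv.funSplitAt v (Fin d)).symm (i, ρ) := by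
    intro m ρ
    funext w
    by_cases hw : w = v
    · subst hw
      simp
    · simp [hw]
  rw [← (Equiv.funSplitAt v (Fin d)).symm.sum_comp, ← (Equiv.funSplitAt v (Fin d)).symm.sum_comp,
    Fintype.sum_prod_type, Fintype.sum_prod_type]
  have hv : ∀ (m : Fin d) (ρ : {w // w ≠ v} → Fin d),
      (Equiv.funSplitAt v (Fin d)).symm (m, ρ) v = m := fun m ρ => by simp
  simp only [hs, hv, Finset.sum_const, Finset.card_univ, Fintype.card_fin, nsmul_eq_mul]
  congr 1
  rw [Fintype.sum_eq_single i]
  · simp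
  · intro m hm
    simp [hm]

lemma sum_sum_comp_update (v : V) (F : (V → Fin d) → ℂ) :
    ∑ η : V → Fin d, ∑ i, F (Function.update η v i) = d * ∑ η, F η := by
  rw [Finset.sum_comm]
  simp only [sum_comp_update]
  rw [← Finset.mul_sum, Finset.sum_comm]
  simp

variable [NeZero d]

/-- The Kraus operators of `channelM U z`, up to normalisation. -/
def krausOp (U : Op Plaq d) (z : Plaq) (s : (Plaq → Fin d) × (Plaq → Fin d)) : LocalOp d :=
  fun i j => star (U (Function.update s.1 z j) (Function.update s.2 (opp z) i))

/-- Of `d ^ 5`, three powers undo the normalisation of `M_z`. The other two arise because `krausOp U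
z s` ignores `s.1 z` and `s.2 (opp z)`. -/
lemma sum_krausOp (U : Op Plaq d) (z : Plaq) (a : LocalOp d) :
    ∑ s, krausOp U z s * a * (krausOp U z s)ᴴ = (d : ℂ) ^ 5 • channelM U z a := by
  have hd : (d : ℂ) ≠ 0 := NeZero.ne _
  have hch : (d : ℂ) ^ 3 • channelM U z a = ptraceExcept (opp z) (Uᴴ * localAt z a * U) := by
    change (d : ℂ) ^ 3 • ((1 / (d : ℂ) ^ 3) • ptraceExcept (opp z) (Uᴴ * localAt z a * U)) = _
    rw [smul_smul, mul_one_div_cancel (pow_ne_zero _ hd), one_smul]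
  have h5 : (d : ℂ) ^ 5 • channelM U z a = (d : ℂ) ^ 2 • ((d : ℂ) ^ 3 • channelM U z a) := by
    rw [smul_smul, ← pow_add]
  rw [h5, hch]
  ext i j
  simp only [Matrix.sum_apply, Matrix.smul_apply, smul_eq_mul, ptraceExcept]
  have hentry : ∀ σ τ : Plaq → Fin d, (Uᴴ * localAt z a * U) σ τ =
      ∑ ξ, ∑ m, star (U ξ σ) * a (ξ z) m * U (Function.update ξ z m) τ := by
    intro σ τ
    rw [Matrix.mul_assoc, Matrix.mul_apply]
    refine Finset.sum_congr rfl fun ξ _ => ?_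
    rw [localAt_mul_apply, Finset.mul_sum]
    refine Finset.sum_congr rfl fun m _ => ?_
    rw [Matrix.conjTranspose_apply, mul_assoc]
  have hk : ∀ ξ η : Plaq → Fin d,
      (krausOp U z (ξ, η) * a * (krausOp U z (ξ, η))ᴴ) i j =
      ∑ l, ∑ m, star (U (Function.update ξ z l) (Function.update η (opp z) i)) * a l m *
        U (Function.update ξ z m) (Function.update η (opp z) j) := by
    intro ξ η
    rw [Matrix.mul_assoc, Matrix.mul_apply]
    refine Finset.sum_congr rfl fun l _ => ?_
    rw [Matrix.mul_apply, Finset.mul_sum]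
    refine Finset.sum_congr rfl fun m _ => ?_
    simp only [krausOp, Matrix.conjTranspose_apply, star_star]
    rw [mul_assoc]
  rw [Fintype.sum_prod_type, Finset.sum_comm]
  have hξ : ∀ η : Plaq → Fin d, ∑ ξ, (krausOp U z (ξ, η) * a * (krausOp U z (ξ, η))ᴴ) i j =
      d * (Uᴴ * localAt z a * U) (Function.update η (opp z) i) (Function.update η (opp z) j) := by
    intro η
    rw [hentry, ← sum_sum_comp_update z]
    refine Finset.sum_congr rfl fun ξ _ => ?_
    rw [hk]
    refine Finset.sum_congr rfl fun l _ => Finset.sum_congr rfl fun m _ => ?_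
    simp
  simp only [hξ]
  rw [← Finset.mul_sum, sq, mul_assoc (d : ℂ) d]
  congr 1
  rw [← sum_comp_update (opp z) i
    (fun η => (Uᴴ * localAt z a * U) η (Function.update η (opp z) j))]
  simp

lemma sum_krausOp_conjTranspose_mul {U : Op Plaq d} (h : U * Uᴴ = 1) (z : Plaq) :
    ∑ s, (krausOp U z s)ᴴ * krausOp U z s = (d : ℂ) ^ 5 • (1 : LocalOp d) := by
  ext j j'
  simp only [Matrix.sum_apply, Matrix.smul_apply, smul_eq_mul, Matrix.mul_apply,
    Matrix.conjTranspose_apply, krausOp, star_star]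
  rw [Fintype.sum_prod_type]
  have hη : ∀ ξ : Plaq → Fin d, ∑ η : Plaq → Fin d, ∑ i,
      U (Function.update ξ z j) (Function.update η (opp z) i) *
        star (U (Function.update ξ z j') (Function.update η (opp z) i)) =
      d * (1 : LocalOp d) j j' := by
    intro ξ
    rw [sum_sum_comp_update (opp z)
      (fun η => U (Function.update ξ z j) η * star (U (Function.update ξ z j') η))]
    have := congrFun (congrFun h (Function.update ξ z j)) (Function.update ξ z j')
    rw [Matrix.mul_apply] at this
    simp only [Matrix.conjTranspose_apply] at this
    rw [this]
    congr 1
    rw [Matrix.one_apply, Matrix.one_apply]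
    refine if_congr ⟨fun e => ?_, fun e => by rw [e]⟩ rfl rfl
    simpa using congrFun e z
  simp only [hη, Finset.sum_const, Finset.card_univ, Fintype.card_pi, Fintype.card_fin,
    Finset.prod_const, nsmul_eq_mul]
  have hc : Fintype.card Plaq = 4 := by simp [Plaq]
  rw [hc]
  push_cast
  ring

lemma isQuantumChannel_channelM {U : Op Plaq d} (h : U * Uᴴ = 1) (z : Plaq) :
    IsQuantumChannel (channelM U z) := by
  have hd : (d : ℂ) ^ 5 ≠ 0 := pow_ne_zero _ (NeZero.ne _)
  set c : ℂ := (((Real.sqrt ((d : ℝ) ^ 5))⁻¹ : ℝ) : ℂ) with hc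
  have hcc : c * star c = ((d : ℂ) ^ 5)⁻¹ := by
    rw [hc, Complex.star_def, Complex.conj_ofReal, ← Complex.ofReal_mul, ← mul_inv,
      Real.mul_self_sqrt (by positivity)]
    push_cast
    rfl
  let ε := Fintype.equivFin ((Plaq → Fin d) × (Plaq → Fin d))
  refine ⟨_, fun n => c • krausOp U z (ε.symm n), fun a => ?_, ?_⟩
  · rw [ε.symm.sum_comp (fun s => (c • krausOp U z s) * a * (c • krausOp U z s)ᴴ)]
    have : ∀ s, (c • krausOp U z s) * a * (c • krausOp U z s)ᴴ =
        ((d : ℂ) ^ 5)⁻¹ • (krausOp U z s * a * (krausOp U z s)ᴴ) := fun s => by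
      rw [Matrix.conjTranspose_smul, smul_mul_assoc, smul_mul_assoc, mul_smul_comm, smul_smul, hcc]
    simp only [this]
    rw [← Finset.smul_sum, sum_krausOp, smul_smul, inv_mul_cancel₀ hd, one_smul]
  · rw [ε.symm.sum_comp (fun s => (c • krausOp U z s)ᴴ * (c • krausOp U z s))]
    have : ∀ s, (c • krausOp U z s)ᴴ * (c • krausOp U z s) =
        ((d : ℂ) ^ 5)⁻¹ • ((krausOp U z s)ᴴ * krausOp U z s) := fun s => by
      rw [Matrix.conjTranspose_smul, smul_mul_assoc, mul_smul_comm, smul_smul, mul_comm (star c),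
        hcc]
    simp only [this]
    rw [← Finset.smul_sum, sum_krausOp_conjTranspose_mul h, smul_smul, inv_mul_cancel₀ hd,
      one_smul]

lemma card_plaq_sub_one : Fintype.card Plaq - 1 = 3 := by simp [Plaq]

lemma channelM_one {U : Op Plaq d} (h : Uᴴ * U = 1) (z : Plaq) : channelM U z 1 = 1 := by
  change (1 / (d : ℂ) ^ 3) • ptraceExcept (opp z) (Uᴴ * localAt z 1 * U) = 1
  rw [localAt_one, Matrix.mul_one, h, ← localAt_one (opp z), ptraceExcept_localAt_self,
    card_plaq_sub_one, smul_smul, one_div_mul_cancel (pow_ne_zero _ (NeZero.ne _)), one_smul]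

lemma trace_channelM {U : Op Plaq d} (h : U * Uᴴ = 1) (z : Plaq) (a : LocalOp d) :
    (channelM U z a).trace = a.trace := by
  change ((1 / (d : ℂ) ^ 3) • ptraceExcept (opp z) (Uᴴ * localAt z a * U)).trace = _
  rw [Matrix.trace_smul, trace_ptraceExcept, Matrix.mul_assoc, Matrix.trace_mul_comm,
    Matrix.mul_assoc, h, Matrix.mul_one, trace_localAt, card_plaq_sub_one, smul_eq_mul, ← mul_assoc,
    one_div_mul_cancel (pow_ne_zero _ (NeZero.ne _)), one_mul]

end Channel

/-! ### Powers of an endomorphism on generalised eigenspaces -/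

section Spectral

open Polynomial

variable {E : Type*} [AddCommGroup E] [Module ℂ E] [FiniteDimensional ℂ E]

/-- Matrix elements of powers are polynomial times exponential on a generalised eigenspace. -/
lemma exists_polynomial_pow_apply (M : Module.End ℂ E) {μ : ℂ} (hμ : μ ≠ 0) {x : E}
    (hx : x ∈ M.maxGenEigenspace μ) (φ : E →ₗ[ℂ] ℂ) :
    ∃ c : ℂ[X], ∀ n : ℕ, φ ((M ^ n) x) = c.eval (n : ℂ) * μ ^ n := by
  obtain ⟨K, hK⟩ := (Module.End.mem_maxGenEigenspace M μ x).1 hx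
  set N : Module.End ℂ E := M - μ • 1 with hN
  have hM : M = N + μ • 1 := by rw [hN, sub_add_cancel]
  have hcomm : Commute N (μ • 1) := (Commute.one_right N).smul_right μ
  have hNz : ∀ j, K ≤ j → (N ^ j) x = 0 := fun j hj => by
    rw [← Nat.sub_add_cancel hj, pow_add, Module.End.mul_apply, hK, map_zero]
  -- With `M = N + μ`, the binomial expansion of `M ^ n` on `x` stops at `N ^ K`, and `n.choose j`
  -- is the polynomial `descPochhammer ℂ j / j!` in `n`.
  refine ⟨∑ j ∈ Finset.range K,
    C (φ ((N ^ j) x) * (μ⁻¹) ^ j / (j.factorial : ℂ)) * descPochhammer ℂ j, fun n => ?_⟩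
  have h1 : φ ((M ^ n) x) =
      ∑ j ∈ Finset.range (n + 1), (n.choose j : ℂ) * μ ^ (n - j) * φ ((N ^ j) x) := by
    conv_lhs => rw [hM, hcomm.add_pow]
    rw [LinearMap.sum_apply, map_sum]
    refine Finset.sum_congr rfl fun j _ => ?_
    rw [_root_.smul_pow, one_pow, ← nsmul_eq_mul', mul_smul_comm, mul_one, LinearMap.smul_apply,
      LinearMap.smul_apply, map_nsmul, map_smul, nsmul_eq_mul, smul_eq_mul, mul_assoc]
  have hterm : ∀ j, (n.choose j : ℂ) * μ ^ (n - j) * φ ((N ^ j) x) =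
      (C (φ ((N ^ j) x) * (μ⁻¹) ^ j / (j.factorial : ℂ)) * descPochhammer ℂ j).eval (n : ℂ) *
        μ ^ n := by
    intro j
    rcases le_or_gt j n with hj | hj
    · have hp : μ ^ n = μ ^ (n - j) * μ ^ j := by rw [← pow_add, Nat.sub_add_cancel hj]
      rw [eval_mul, eval_C, hp, Nat.cast_choose_eq_descPochhammer_div, inv_pow]
      field_simp
    · have h0 : (descPochhammer ℂ j).eval (n : ℂ) = 0 := by
        have := Nat.cast_choose_eq_descPochhammer_div ℂ n j
        rw [Nat.choose_eq_zero_of_lt hj, Nat.cast_zero, eq_comm, div_eq_zero_iff] at this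
        exact this.resolve_right (Nat.cast_ne_zero.2 j.factorial_ne_zero)
      rw [eval_mul, h0, Nat.choose_eq_zero_of_lt hj]
      simp
  have h2 : ∀ m, n + 1 ≤ m → φ ((M ^ n) x) =
      ∑ j ∈ Finset.range m, (n.choose j : ℂ) * μ ^ (n - j) * φ ((N ^ j) x) := by
    intro m hm
    rw [h1]
    refine Finset.sum_subset (Finset.range_subset_range.2 hm) fun j _ hj => ?_
    rw [Nat.choose_eq_zero_of_lt (by simpa using hj)]
    simp
  -- Padding beyond both `n + 1` and `K` compares the two sums: extra terms vanish through the
  -- binomial coefficient or through nilpotency.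
  rw [h2 (n + 1 + K) (by omega), eval_finsetSum, Finset.sum_mul]
  simp only [← hterm]
  refine (Finset.sum_subset (Finset.range_subset_range.2 (by omega)) fun j _ hj => ?_).symm
  rw [hNz j (by simpa using hj), map_zero, mul_zero]

/-- The same along even powers, including the eigenvalue `0`. -/
lemma exists_polynomial_pow_two_mul_apply (M : Module.End ℂ E) {μ : ℂ} {x : E}
    (hx : x ∈ M.maxGenEigenspace μ) (φ : E →ₗ[ℂ] ℂ) :
    ∃ c : ℂ[X], ∀ t : ℕ, (t = 0 ∨ M.maxGenEigenspaceIndex 0 ≤ 2 * t) →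
      φ ((M ^ (2 * t)) x) = c.eval (t : ℂ) * μ ^ (2 * t) := by
  by_cases hμ : μ = 0
  · subst hμ
    -- For eigenvalue 0 the constant gives the value at `t = 0` through `0 ^ 0 = 1`; for `t > 0`
    -- both sides vanish, as `2t` is at least the index.
    refine ⟨C (φ x), fun t ht => ?_⟩
    rcases Nat.eq_zero_or_pos t with rfl | hpos
    · simp
    · have hν := ht.resolve_left hpos.ne'
      rw [Module.End.maxGenEigenspace_eq, Module.End.mem_genEigenspace_nat, zero_smul, sub_zero,
        LinearMap.mem_ker] at hx
      rw [← Nat.sub_add_cancel hν, pow_add, Module.End.mul_apply, hx, map_zero, map_zero,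
        Nat.sub_add_cancel hν, zero_pow (by omega), mul_zero]
  · obtain ⟨c, hc⟩ := exists_polynomial_pow_apply M hμ hx φ
    refine ⟨c.comp (C 2 * X), fun t _ => ?_⟩
    rw [hc]
    simp

lemma exists_root_enumeration {n : ℕ} [NeZero n] {P : ℂ[X]} (hP : P.Monic) (hdeg : P.natDegree = n)
    {r : ℂ} (hr : P.IsRoot r) :
    ∃ ev : Fin n → ℂ, P = ∏ χ, (X - C (ev χ)) ∧ ev 0 = r := by
  have hmem : r ∈ P.roots := (mem_roots hP.ne_zero).2 hr
  -- The prescribed root is listed first, so that it receives index 0.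
  set l : List ℂ := r :: (P.roots.erase r).toList with hl
  have hml : (l : Multiset ℂ) = P.roots := by
    rw [hl, ← Multiset.cons_coe, Multiset.coe_toList, Multiset.cons_erase hmem]
  have hsplit : P.Splits := IsAlgClosed.splits P
  have hlen : l.length = n := by
    rw [← Multiset.coe_card, hml, ← hdeg, hsplit.natDegree_eq_card_roots]
  subst hlen
  refine ⟨l.get, ?_, ?_⟩
  · conv_lhs => rw [hsplit.eq_prod_roots_of_monic hP, ← hml]
    rw [Multiset.map_coe, Multiset.prod_coe, ← List.prod_ofFn]
    congr 1
    have h : List.map (fun a : ℂ => X - C a) (List.ofFn l.get) =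
        List.ofFn ((fun a : ℂ => X - C a) ∘ l.get) := List.map_ofFn
    rw [List.ofFn_get] at h
    exact h
  · rfl

end Spectral

/-! ### Expansion of the correlations in the eigenvalues of the single-site map -/

section Expansion

open Polynomial

variable {d : ℕ} [NeZero d] {U : Op Plaq d}

lemma exists_channelM_eigenvalues (h1 : Uᴴ * U = 1) (z : Plaq) :
    ∃ ev : Fin (d ^ 2) → ℂ, (channelM U z).charpoly = ∏ χ, (X - C (ev χ)) ∧ ev 0 = 1 := by
  refine exists_root_enumeration (LinearMap.charpoly_monic _) ?_ ?_
  · rw [LinearMap.charpoly_natDegree, Module.finrank_matrix]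
    simp [sq]
  · rw [← Module.End.hasEigenvalue_iff_isRoot_charpoly]
    refine Module.End.hasEigenvalue_of_hasEigenvector (x := 1) ⟨?_, one_ne_zero⟩
    rw [Module.End.mem_eigenspace_iff, channelM_one h1, one_smul]

/-- The traceless part of an operator. -/
def tracelessPart (x : LocalOp d) : LocalOp d := x - (x.trace / d) • 1

/-- Since `M_z` preserves the trace, each factor `M_z - μ` multiplies it by `1 - μ ≠ 0`. -/
lemma trace_eq_zero_of_mem_maxGenEigenspace (h2 : U * Uᴴ = 1) (z : Plaq) {μ : ℂ} (hμ : μ ≠ 1)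
    {x : LocalOp d} (hx : x ∈ (channelM U z).maxGenEigenspace μ) : x.trace = 0 := by
  obtain ⟨k, hk⟩ := (Module.End.mem_maxGenEigenspace _ μ x).1 hx
  have key : ∀ k : ℕ, ((((channelM U z) - μ • 1) ^ k) x).trace = (1 - μ) ^ k * x.trace := by
    intro k
    induction k with
    | zero => simp
    | succ k ih =>
      rw [pow_succ', Module.End.mul_apply, LinearMap.sub_apply, Matrix.trace_sub,
        trace_channelM h2, LinearMap.smul_apply, Module.End.one_apply, Matrix.trace_smul, ih,
        smul_eq_mul]
      ring
  have := key k
  rw [hk, Matrix.trace_zero, eq_comm, mul_eq_zero] at this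
  exact this.resolve_left (pow_ne_zero _ (sub_ne_zero.2 hμ.symm))

/-- Decompose `b` into generalised eigenvectors. These need not be traceless individually, so the
claim is proved for their traceless parts, which is additive and returns `b` itself in the end. -/
lemma exists_expansion (h1 : Uᴴ * U = 1) (h2 : U * Uᴴ = 1) (z : Plaq) {ev : Fin (d ^ 2) → ℂ}
    (hev : (channelM U z).charpoly = ∏ χ, (X - C (ev χ))) (hev0 : ev 0 = 1)
    (φ : LocalOp d →ₗ[ℂ] ℂ) {b : LocalOp d} (hb : b.trace = 0) :
    ∃ c : Fin (d ^ 2) → ℂ[X], ∀ t : ℕ,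
      (t = 0 ∨ (channelM U z).maxGenEigenspaceIndex 0 ≤ 2 * t) →
      φ (((channelM U z) ^ (2 * t)) b) =
        ∑ χ ∈ Finset.univ.erase 0, (c χ).eval (t : ℂ) * ev χ ^ (2 * t) := by
  set M := channelM U z with hM
  have hd : (d : ℂ) ≠ 0 := NeZero.ne _
  have hone : (1 : LocalOp d) ∈ M.maxGenEigenspace 1 := by
    rw [Module.End.mem_maxGenEigenspace]
    refine ⟨1, ?_⟩
    rw [pow_one, LinearMap.sub_apply, hM, channelM_one h1]
    simp
  have htr1 : (1 : LocalOp d).trace = d := by simp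
  have single : ∀ {μ : ℂ} {x : LocalOp d} (χ : Fin (d ^ 2)), χ ≠ 0 → ev χ = μ →
      x ∈ M.maxGenEigenspace μ →
      ∃ c : Fin (d ^ 2) → ℂ[X], ∀ t : ℕ, (t = 0 ∨ M.maxGenEigenspaceIndex 0 ≤ 2 * t) →
        φ ((M ^ (2 * t)) x) =
          ∑ χ ∈ Finset.univ.erase 0, (c χ).eval (t : ℂ) * ev χ ^ (2 * t) := by
    rintro _ x χ hχ rfl hx
    obtain ⟨c, hc⟩ := exists_polynomial_pow_two_mul_apply M hx φ
    refine ⟨fun χ' => if χ' = χ then c else 0, fun t ht => ?_⟩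
    rw [hc t ht, Finset.sum_eq_single_of_mem χ (by simpa using hχ)]
    · simp
    · intro χ' _ hne
      simp [hne]
  have hzero : ∃ c : Fin (d ^ 2) → ℂ[X], ∀ t : ℕ, (t = 0 ∨ M.maxGenEigenspaceIndex 0 ≤ 2 * t) →
      φ ((M ^ (2 * t)) 0) = ∑ χ ∈ Finset.univ.erase 0, (c χ).eval (t : ℂ) * ev χ ^ (2 * t) :=
    ⟨0, fun t _ => by simp⟩
  have main : ∀ x ∈ ⨆ μ, M.maxGenEigenspace μ,
      ∃ c : Fin (d ^ 2) → ℂ[X], ∀ t : ℕ, (t = 0 ∨ M.maxGenEigenspaceIndex 0 ≤ 2 * t) →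
        φ ((M ^ (2 * t)) (tracelessPart x)) =
          ∑ χ ∈ Finset.univ.erase 0, (c χ).eval (t : ℂ) * ev χ ^ (2 * t) := by
    intro x hx
    refine Submodule.iSup_induction _ (motive := fun x => ∃ c : Fin (d ^ 2) → ℂ[X],
      ∀ t : ℕ, (t = 0 ∨ M.maxGenEigenspaceIndex 0 ≤ 2 * t) →
        φ ((M ^ (2 * t)) (tracelessPart x)) =
          ∑ χ ∈ Finset.univ.erase 0, (c χ).eval (t : ℂ) * ev χ ^ (2 * t)) hx ?_ (by simpa [tracelessPart] using hzero) ?_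
    rotate_left
    · intro x y hx hy
      obtain ⟨c, hc⟩ := hx
      obtain ⟨c', hc'⟩ := hy
      refine ⟨c + c', fun t ht => ?_⟩
      have hadd : tracelessPart (x + y) = tracelessPart x + tracelessPart y := by
        simp only [tracelessPart, Matrix.trace_add, add_div, add_smul]
        abel
      rw [hadd, map_add, map_add, hc t ht, hc' t ht, ← Finset.sum_add_distrib]
      refine Finset.sum_congr rfl fun χ _ => ?_
      rw [Pi.add_apply, eval_add, add_mul]
    · intro μ x hx
      by_cases hμ : μ = 1
      · subst hμ
        -- A further copy of the eigenvalue 1 can carry the term. Otherwise 1 is algebraically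
        -- simple, its eigenspace is spanned by the identity, and the traceless part is zero.
        by_cases hex : ∃ χ, χ ≠ 0 ∧ ev χ = 1
        · obtain ⟨χ, hχ, hχ1⟩ := hex
          exact single χ hχ hχ1 (Submodule.sub_mem _ hx (Submodule.smul_mem _ _ hone))
        · push Not at hex
          have hfin : Module.finrank ℂ (M.maxGenEigenspace 1) = 1 := by
            rw [LinearMap.finrank_maxGenEigenspace_eq, hev,
              ← Finset.mul_prod_erase _ _ (Finset.mem_univ 0), hev0]
            have hne : (∏ χ ∈ Finset.univ.erase 0, (X - C (ev χ))).eval 1 ≠ 0 := by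
              rw [eval_prod, Finset.prod_ne_zero_iff]
              intro χ hχ
              rw [eval_sub, eval_X, eval_C, sub_ne_zero]
              exact (hex χ (Finset.ne_of_mem_erase hχ)).symm
            have hne0 : (∏ χ ∈ Finset.univ.erase 0, (X - C (ev χ))) ≠ 0 := fun h => hne (by simp [h])
            rw [rootMultiplicity_mul (mul_ne_zero (X_sub_C_ne_zero 1) hne0),
              rootMultiplicity_X_sub_C_self, rootMultiplicity_eq_zero hne]
          obtain ⟨r, hr⟩ := (finrank_eq_one_iff_of_nonzero'
            (⟨1, hone⟩ : M.maxGenEigenspace 1)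
            (fun h => one_ne_zero (congrArg Subtype.val h))).1 hfin ⟨x, hx⟩
          have hr' : r • (1 : LocalOp d) = x := congrArg Subtype.val hr
          have : tracelessPart x = 0 := by
            rw [tracelessPart, ← hr', Matrix.trace_smul, htr1, smul_eq_mul, mul_div_cancel_right₀ _ hd,
              sub_self]
          rw [this]
          exact hzero
      · have htr : tracelessPart x = x := by
          rw [tracelessPart, trace_eq_zero_of_mem_maxGenEigenspace h2 z hμ hx]
          simp
        rw [htr]
        by_cases hroot : M.charpoly.IsRoot μ
        · rw [hev, IsRoot.def, eval_prod, Finset.prod_eq_zero_iff] at hroot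
          obtain ⟨χ, -, hχ⟩ := hroot
          rw [eval_sub, eval_X, eval_C, sub_eq_zero] at hχ
          refine single χ ?_ hχ.symm hx
          rintro rfl
          exact hμ (hχ.trans hev0)
        · have hfin : Module.finrank ℂ (M.maxGenEigenspace μ) = 0 := by
            rw [LinearMap.finrank_maxGenEigenspace_eq, rootMultiplicity_eq_zero hroot]
          rw [Submodule.finrank_eq_zero] at hfin
          rw [hfin, Submodule.mem_bot] at hx
          rw [hx]
          exact hzero
  have htop : b ∈ ⨆ μ, M.maxGenEigenspace μ := by
    rw [Module.End.iSup_maxGenEigenspace_eq_top]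
    trivial
  have hbt : tracelessPart b = b := by simp [tracelessPart, hb]
  rw [← hbt]
  exact main b htop

end Expansion

end

end TernaryCircuit

theorem mainTheorem2 (d : ℕ) [NeZero d] (U : TernaryCircuit.Op TernaryCircuit.Plaq d)
    (hU : TernaryCircuit.IsTernaryUnitary U) :
    (∀ z : TernaryCircuit.Plaq,
      TernaryCircuit.IsQuantumChannel (TernaryCircuit.channelM U z) ∧
      TernaryCircuit.channelM U z 1 = 1) ∧
    (∀ (L : ℕ) [NeZero L] (t : ℕ), Even L → 4 * t ≤ L →
      ∀ (a b : TernaryCircuit.LocalOp d), a.trace = 0 → b.trace = 0 →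
      ∀ x y : TernaryCircuit.Site L,
        (¬ TernaryCircuit.OnLightRay t x y →
          TernaryCircuit.correlation L U a b x y t = 0) ∧
        (TernaryCircuit.OnLightRay t x y →
          TernaryCircuit.cycDist x.1 y.1 = 2 * t ∧
          TernaryCircuit.cycDist x.2 y.2 = 2 * t ∧
          TernaryCircuit.correlation L U a b x y t =
            (1 / (d : ℂ)) *
              (((TernaryCircuit.channelM U (TernaryCircuit.posInOdd y)) ^ (2 * t)) b
                * a).trace)) ∧
    (∀ z : TernaryCircuit.Plaq, ∃ ev : Fin (d ^ 2) → ℂ,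
      (TernaryCircuit.channelM U z).charpoly =
        ∏ χ, (Polynomial.X - Polynomial.C (ev χ)) ∧
      ev 0 = 1 ∧
      ∀ (a b : TernaryCircuit.LocalOp d), a.trace = 0 → b.trace = 0 →
        ∃ c : Fin (d ^ 2) → Polynomial ℂ,
          ∀ (L : ℕ) [NeZero L] (t : ℕ), Even L → 4 * t ≤ L →
          (t = 0 ∨ (TernaryCircuit.channelM U z).maxGenEigenspaceIndex 0 ≤ 2 * t) →
          ∀ x y : TernaryCircuit.Site L, TernaryCircuit.posInOdd y = z →
          TernaryCircuit.OnLightRay t x y →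
            TernaryCircuit.correlation L U a b x y t =
              ∑ χ ∈ Finset.univ.erase 0, (c χ).eval (t : ℂ) * ev χ ^ (2 * t)) := by
  refine ⟨fun z => ⟨TernaryCircuit.isQuantumChannel_channelM hU.1.2 z,
    TernaryCircuit.channelM_one hU.1.1 z⟩, ?_, ?_⟩
  · intro L _ t hL ht a b _ hb x y
    refine ⟨TernaryCircuit.correlation_off_ray hL hU ht a hb, fun h => ⟨?_, ?_,
      TernaryCircuit.correlation_on_ray hL hU ht a b h⟩⟩
    · rw [h.1]
      exact TernaryCircuit.cycDist_ray ht y.1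
    · rw [h.2]
      exact TernaryCircuit.cycDist_ray ht y.2
  · intro z
    obtain ⟨ev, hev, hev0⟩ := TernaryCircuit.exists_channelM_eigenvalues hU.1.1 z
    refine ⟨ev, hev, hev0, fun a b _ hb => ?_⟩
    obtain ⟨c, hc⟩ := TernaryCircuit.exists_expansion hU.1.1 hU.1.2 z hev hev0
      -- The functional `x ↦ Tr[x a] / d` involves neither `L`, `x`, `y` nor `t`, so the polynomials
      -- are uniform in them.
      ((1 / (d : ℂ)) • Matrix.traceLinearMap (Fin d) ℂ ℂ ∘ₗ LinearMap.mulRight ℂ a) hb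
    refine ⟨c, fun L _ t hL ht hν x y hy h => ?_⟩
    rw [TernaryCircuit.correlation_on_ray hL hU ht a b h, hy, ← hc t hν]
    rfl
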